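/- Rows are numbered from top to bottom and columns from left to right. Let $P$ be an increasing tableau of straight shape $\mu$: a filling of the Young diagram of a partition $\mu$ by positive integers which strictly increase along rows and down columns. **Reverse $K$-jeu de taquin.** Let $T$ be an increasing tableau of skew shape $\nu/\lambda$ inside a rectangle $\Lambda$. An outer corner is a maximally northwest box of $\Lambda/\nu$. For a set $\{x_i\}$ of outer corners, ${\tt revKjdt}_{\{x_i\}}(T)$ is obtained as follows. Fill the $x_i$ with $\bullet$, and let $m$ be the largest label of $T$. For $k=m,m-1,\ldots,1$ in this order, consider the set $R_k$ of boxes filled with $\bullet$ or $k$ and, in every component of $R_k$ (with respect to horizontal and vertical adjacency) that has more than one box, replace each $k$ by $\bullet$ and each $\bullet$ by $k$. Finally erase all $\bullet$. The result is a tableau of skew shape $\nu'/\lambda'$, where $\nu'=\nu\cup\{x_i\}$ and $\lambda'$ consists of the boxes of $\nu'$ without label. The reverse $K$-rectification of $T$ in $\Lambda$ is the result of repeatedly sliding into the leftmost outer corner (a set with one element) until there is no outer corner left, i.e. $\nu=\Lambda$. **The left key.** The left key $K_{-}(P)$ has as many columns as $P$. Its first column is the first column of $P$. For $\ell\ge 1$,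 let $P^{(\ell+1)}$ be the tableau formed by the first $\ell+1$ columns of $P$, and let $\Lambda^{(\ell+1)}$ be the smallest rectangle that contains it. The $(\ell+1)$-st column of $K_{-}(P)$ is the leftmost column of the reverse $K$-rectification of $P^{(\ell+1)}$ in $\Lambda^{(\ell+1)}$, pushed up to the top. **Theorem.** For every increasing tableau $P$ of straight shape $\mu$, the left key $K_{-}(P)$ has shape $\mu$, and it is a key: it is a semistandard tableau (weakly increasing along rows, strictly increasing down columns), and for every $i\ge 2$ the set of entries of its column $i$ is contained in the set of entries of its column $i-1$. -/

import Mathlib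

/-!  Increasing tableaux, reverse K-jeu de taquin and left keys.

Boxes are pairs `(row, column)` in matrix (English) coordinates, counted from `0`, so that `b ≤ c` in
the product order of `ℕ × ℕ` says that `b` is weakly northwest of `c`. -/

namespace KJdt

/-- An increasing tableau of straight shape `μ`: a filling of the boxes of `μ` by positive integers,
strictly increasing along rows and down columns. As in `SemistandardYoungTableau`, the value `0` is
assigned to the pairs outside `μ`. -/
structure IncreasingTableau (μ : YoungDiagram) where
  entry : ℕ → ℕ → ℕ
  row_strict : ∀ {i j₁ j₂ : ℕ}, j₁ < j₂ → (i, j₂) ∈ μ → entry i j₁ < entry i j₂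
  col_strict : ∀ {i₁ i₂ j : ℕ}, i₁ < i₂ → (i₂, j) ∈ μ → entry i₁ j < entry i₂ j
  pos : ∀ {i j : ℕ}, (i, j) ∈ μ → 0 < entry i j
  zeros : ∀ {i j : ℕ}, (i, j) ∉ μ → entry i j = 0

/-- The content of a box: nothing, the symbol `•`, or a label. -/
inductive Cell where
  | blank : Cell
  | bullet : Cell
  | label (n : ℕ) : Cell

/-- The label of a box (`0` if there is none). -/
def Cell.value : Cell → ℕ
  | Cell.label n => n
  | _ => 0

/-- A filling of (some of) the boxes of the quadrant. -/
abbrev Filling : Type := ℕ × ℕ → Cell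

/-- The set of boxes that carry a label. -/
def Filling.shape (F : Filling) : Set (ℕ × ℕ) := {b | ∃ n, F b = Cell.label n}

/-- The set of labels in column `j`. -/
def Filling.columnSet (F : Filling) (j : ℕ) : Set ℕ := {n | ∃ i, F (i, j) = Cell.label n}

/-- Semistandard: labels weakly increase along rows and strictly increase down columns. -/
def Filling.IsSemistandard (F : Filling) : Prop :=
  (∀ i j₁ j₂ a b : ℕ, j₁ < j₂ → F (i, j₁) = Cell.label a → F (i, j₂) = Cell.label b → a ≤ b) ∧
  (∀ i₁ i₂ j a b : ℕ, i₁ < i₂ → F (i₁, j) = Cell.label a → F (i₂, j) = Cell.label b → a < b)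

/-- A key: a semistandard filling in which the set of labels of each column is contained in the set
of labels of the preceding column. -/
def Filling.IsKey (F : Filling) : Prop :=
  F.IsSemistandard ∧ ∀ j : ℕ, F.columnSet (j + 1) ⊆ F.columnSet j

/-- Two boxes are adjacent, horizontally or vertically. -/
def Adjacent (b c : ℕ × ℕ) : Prop :=
  (b.1 = c.1 ∧ (b.2 + 1 = c.2 ∨ c.2 + 1 = b.2)) ∨ (b.2 = c.2 ∧ (b.1 + 1 = c.1 ∨ c.1 + 1 = b.1))

/-- Two boxes of `R` lie in the same component of `R`: they are joined by a path of adjacent boxes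
of `R`. -/
def SameComponent (R : Set (ℕ × ℕ)) (b c : ℕ × ℕ) : Prop :=
  b ∈ R ∧ Relation.ReflTransGen (fun x y => Adjacent x y ∧ y ∈ R) b c

/-- The box `b` lies in `R`, in a component with more than one box. -/
def InNonsingletonComponent (R : Set (ℕ × ℕ)) (b : ℕ × ℕ) : Prop :=
  ∃ c, c ≠ b ∧ SameComponent R b c

/-- A box of `R` lies in a component with more than one box iff it is adjacent to a box of `R`. -/
theorem inNonsingletonComponent_iff (R : Set (ℕ × ℕ)) (b : ℕ × ℕ) :
    InNonsingletonComponent R b ↔ b ∈ R ∧ ∃ c ∈ R, Adjacent b c := by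
  constructor
  · rintro ⟨c, hcb, hb, h⟩
    rcases Relation.ReflTransGen.cases_head h with h | ⟨d, ⟨h1, h2⟩, -⟩
    · exact absurd h.symm hcb
    · exact ⟨hb, d, h2, h1⟩
  · rintro ⟨hb, c, hc, h⟩
    refine ⟨c, ?_, hb, Relation.ReflTransGen.single ⟨h, hc⟩⟩
    rintro rfl
    unfold Adjacent at h
    omega

/-- The boxes filled with `•` or with the label `i`. -/
def ribbon (i : ℕ) (F : Filling) : Set (ℕ × ℕ) := {b | F b = Cell.bullet ∨ F b = Cell.label i}

/-- The other one of the two symbols `•` and `i`. -/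
def Cell.other (i : ℕ) : Cell → Cell
  | Cell.bullet => Cell.label i
  | _ => Cell.bullet

open Classical in
/-- Apply `switch` to the ribbon of the boxes filled with `•` or `i`: in every non-singleton
component each box is filled with the other symbol. -/
noncomputable def switch (i : ℕ) (F : Filling) : Filling := fun b =>
  if InNonsingletonComponent (ribbon i F) b then (F b).other i else F b

/-- Apply `switch` for the labels `m`, `m - 1`, …, `1`, in this order. -/
noncomputable def switchDown : ℕ → Filling → Filling
  | 0, F => F
  | m + 1, F => switchDown m (switch (m + 1) F)

/-- Put the symbol `•` into the boxes of `X`. -/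
def placeBullets (X : Finset (ℕ × ℕ)) (F : Filling) : Filling := fun b =>
  if b ∈ X then Cell.bullet else F b

/-- Erase the symbols `•`. -/
def eraseBullets (F : Filling) : Filling := fun b =>
  match F b with
  | Cell.bullet => Cell.blank
  | c => c

/-- A filling of a skew shape `ν/λ`: `outer` is the set of boxes of `ν`, and `λ` consists of the
boxes of `ν` without label. -/
structure SkewFilling where
  outer : Finset (ℕ × ℕ)
  fill : Filling

/-- The largest label of a filling of a skew shape. -/
def SkewFilling.maxLabel (T : SkewFilling) : ℕ := T.outer.sup fun b => (T.fill b).value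

/-- The slide `revKjdt` of `T` into the set `X` of outer corners. -/
noncomputable def revKjdt (X : Finset (ℕ × ℕ)) (T : SkewFilling) : SkewFilling where
  outer := T.outer ∪ X
  fill := eraseBullets (switchDown T.maxLabel (placeBullets X T.fill))

/-- The outer corners of a skew shape `ν/λ` in `Λ`: the maximally northwest boxes of `Λ/ν`. -/
def outerCorners (Lam nu : Finset (ℕ × ℕ)) : Finset (ℕ × ℕ) :=
  {b ∈ Lam \ nu | ∀ c ∈ Lam \ nu, c ≤ b → c = b}

/-- The set consisting of the leftmost outer corner (empty if there is no outer corner). -/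
def leftmostOuterCorner (Lam nu : Finset (ℕ × ℕ)) : Finset (ℕ × ℕ) :=
  {b ∈ outerCorners Lam nu | ∀ c ∈ outerCorners Lam nu, b.2 ≤ c.2}

/-- There is at most one leftmost outer corner. -/
theorem eq_of_mem_leftmostOuterCorner {Lam nu : Finset (ℕ × ℕ)} {b c : ℕ × ℕ}
    (hb : b ∈ leftmostOuterCorner Lam nu) (hc : c ∈ leftmostOuterCorner Lam nu) : b = c := by
  obtain ⟨hbo, hb3⟩ := Finset.mem_filter.1 hb
  obtain ⟨hco, hc3⟩ := Finset.mem_filter.1 hc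
  obtain ⟨hb1, hb2⟩ := Finset.mem_filter.1 hbo
  obtain ⟨hc1, hc2⟩ := Finset.mem_filter.1 hco
  have h : b.2 = c.2 := le_antisymm (hb3 c hco) (hc3 b hbo)
  rcases le_total b.1 c.1 with h' | h'
  · exact hc2 b hb1 ⟨h', h.le⟩
  · exact (hb2 c hc1 ⟨h', h.ge⟩).symm

/-- As long as `Λ/ν` is not empty there is a leftmost outer corner. -/
theorem leftmostOuterCorner_nonempty {Lam nu : Finset (ℕ × ℕ)} (h : (Lam \ nu).Nonempty) :
    (leftmostOuterCorner Lam nu).Nonempty := by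
  obtain ⟨b, hb⟩ := (Lam \ nu).exists_minimal h
  have hne : (outerCorners Lam nu).Nonempty :=
    ⟨b, Finset.mem_filter.2 ⟨hb.1, fun c hc hcb => le_antisymm hcb (hb.2 hc hcb)⟩⟩
  obtain ⟨c, hc, hmin⟩ := (outerCorners Lam nu).exists_min_image Prod.snd hne
  exact ⟨c, Finset.mem_filter.2 ⟨hc, hmin⟩⟩

/-- One step of the reverse K-rectification inside `Λ`: slide into the leftmost outer corner. -/
noncomputable def revStep (Lam : Finset (ℕ × ℕ)) (T : SkewFilling) : SkewFilling :=
  revKjdt (leftmostOuterCorner Lam T.outer) T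

/-- The reverse K-rectification of `T` inside `Λ`, always sliding into the leftmost outer corner.
Every slide adds one box to `ν`, so that after `|Λ/ν|` slides no outer corner is left. -/
noncomputable def revKrect (Lam : Finset (ℕ × ℕ)) (T : SkewFilling) : SkewFilling :=
  (revStep Lam)^[(Lam \ T.outer).card] T

/-- The reverse K-rectification ends only when `Λ/ν` has become empty. -/
theorem revKrect_outer (Lam : Finset (ℕ × ℕ)) (T : SkewFilling) :
    Lam \ (revKrect Lam T).outer = ∅ := by
  unfold revKrect
  induction hk : (Lam \ T.outer).card generalizing T with
  | zero => simpa using hk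
  | succ k ih =>
    rw [Function.iterate_succ_apply]
    apply ih
    obtain ⟨b, hb⟩ := leftmostOuterCorner_nonempty (Lam := Lam) (nu := T.outer)
      (Finset.card_pos.1 (by omega))
    have hX : leftmostOuterCorner Lam T.outer = {b} :=
      Finset.eq_singleton_iff_unique_mem.2
        ⟨hb, fun c hc => eq_of_mem_leftmostOuterCorner hc hb⟩
    have hmem : b ∈ Lam \ T.outer := (Finset.mem_filter.1 (Finset.mem_filter.1 hb).1).1
    have he : Lam \ (revStep Lam T).outer = (Lam \ T.outer).erase b := by
      ext c
      simp only [revStep, revKjdt, hX, Finset.mem_sdiff, Finset.mem_union, Finset.mem_singleton,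
        Finset.mem_erase]
      tauto
    rw [he, Finset.card_erase_of_mem hmem, hk]
    rfl

/-- The smallest rectangle (with northwest box `(0, 0)`) that contains the boxes of `S`. -/
def boundingRectangle (S : Finset (ℕ × ℕ)) : Finset (ℕ × ℕ) :=
  Finset.range (S.sup fun b => b.1 + 1) ×ˢ Finset.range (S.sup fun b => b.2 + 1)

/-- The increasing tableau formed by the first `k` columns of `P`. -/
def IncreasingTableau.firstColumns {μ : YoungDiagram} (P : IncreasingTableau μ) (k : ℕ) :
    SkewFilling where
  outer := {b ∈ μ.cells | b.2 < k}
  fill := fun b => if b ∈ μ.cells ∧ b.2 < k then Cell.label (P.entry b.1 b.2) else Cell.blank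

/-- The labels of column `j` of `F` in rows `0, …, r - 1`, from top to bottom, with the boxes that
carry no label skipped. -/
def columnList (F : Filling) (r j : ℕ) : List ℕ :=
  (List.range r).filterMap fun i =>
    match F (i, j) with
    | Cell.label n => some n
    | _ => none

/-- The columns of the left key: column `0` is that of `P`, and column `l` (for `1 ≤ l`) is the
leftmost column of the reverse K-rectification of the first `l + 1` columns of `P` inside their
bounding rectangle. -/
noncomputable def leftKeyColumn {μ : YoungDiagram} (P : IncreasingTableau μ) : ℕ → List ℕ
  | 0 => columnList (P.firstColumns 1).fill (μ.colLen 0) 0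
  | l + 1 =>
    columnList (revKrect (boundingRectangle (P.firstColumns (l + 2)).outer)
      (P.firstColumns (l + 2))).fill (μ.colLen 0) 0

/-- The left key of `P`: it has as many columns as `P` has, and they are upward-justified. -/
noncomputable def leftKey {μ : YoungDiagram} (P : IncreasingTableau μ) : Filling := fun b =>
  if b.2 < μ.rowLen 0 then
    match (leftKeyColumn P b.2)[b.1]? with
    | some n => Cell.label n
    | none => Cell.blank
  else Cell.blank

end KJdt

/-!
The slides of a reverse K-rectification are described by a growth diagram `G u k`, the order ideal of
the boxes that are empty or carry a label `≤ k` after `u` slides. Consecutive ideals differ by rook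
strips, and one switch of `•` with a label is a local rule (`switchShape`) for a square of the
diagram; `EncodesPartialSlide.switch` is the dictionary.

*Length of the columns.* Read in the other direction, the diagram has at each height `k` a tableau of
slide numbers, whose label `v` fills the boxes that `G · k` gains at slide `v`. A square of the
diagram is a jeu de taquin switch for these tableaux too, and it preserves the lengths of strictly
decreasing subsequences of the row reading word (`IsGrowthDiagram.hasDecreasing_mixed_succ`): if a
slide number leaves a row, either it can be used in the neighbouring row, or a conflict with a label
there provides a substitute in the old row. At the top height the tableau of slide numbers fills the
complement of `μ` in the rectangle. There the maximal length is the number of boxes missing in the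
last column, since the slide numbers increase along that column and all missing boxes lie in its
rows. At height `0` the tableau has straight shape, and the maximal length is its number of rows,
which is the number of empty boxes of the leftmost column. So the leftmost column of the
rectification is as long as the last column of the given tableau
(`IsGrowthDiagram.mem_column_zero_iff`).

*Inclusion of the columns.* By the local rule a slide can only remove labels from the leftmost column
(`IsGrowthDiagram.label_mem_column_zero`). The local rule commutes with the restriction to the first
columns, and the slides into leftmost corners fill the columns from left to right; hence the
rectification of the first `m + 1` columns begins with that of the first `m` columns
(`IncreasingTableau.rectGrowth_succ_inter_columns`). So each column of the left key is contained in
the preceding one. Strictly increasing columns that are nested in this way form a semistandard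
tableau (`getElem_le_getElem_of_subset`).
-/

namespace KJdt

/-! ### Rook extensions and the local rule -/

/-- `β` is obtained from `α` by adding a rook strip: `α ⊆ β` are straight shapes (possibly infinite
order ideals of the quadrant) and no two boxes of `β \ α` are comparable. -/
structure RookExtension (α β : Set (ℕ × ℕ)) : Prop where
  isLowerSet_left : IsLowerSet α
  isLowerSet_right : IsLowerSet β
  subset : α ⊆ β
  eq_of_le : ∀ {b c : ℕ × ℕ}, b ∉ α → c ∈ β → b ≤ c → b = c

/-- The local rule of K-theoretic growth diagrams. Let `α ⊆ β ⊆ γ`, where `β \ α` carries a label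
and `γ \ β` carries `•`. The result is the shape `δ` with `α ⊆ δ ⊆ γ` such that after the switch
the symbols `•` fill `δ \ α` and the label fills `γ \ δ`. -/
def switchShape (α β γ : Set (ℕ × ℕ)) : Set (ℕ × ℕ) :=
  {b | b ∈ γ ∧ (b ∈ α ∨ (b ∈ β ∧ ∃ c ∈ γ, c ∉ β ∧ Adjacent b c) ∨
    (b ∉ β ∧ ∀ c ∈ β, c ∉ α → ¬ Adjacent b c))}

theorem Adjacent.symm {b c : ℕ × ℕ} (h : Adjacent b c) : Adjacent c b := by
  unfold Adjacent at *; omega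

theorem Adjacent.ne {b c : ℕ × ℕ} (h : Adjacent b c) : b ≠ c := by
  rintro rfl; unfold Adjacent at h; omega

theorem Adjacent.le_or_le {b c : ℕ × ℕ} (h : Adjacent b c) : b ≤ c ∨ c ≤ b := by
  simp only [Prod.le_def]; unfold Adjacent at h; omega

/-- Adjacent boxes, the second of which lies outside an order ideal that contains the first one. -/
theorem Adjacent.le_of_mem {β : Set (ℕ × ℕ)} (hβ : IsLowerSet β) {b c : ℕ × ℕ}
    (h : Adjacent b c) (hb : b ∈ β) (hc : c ∉ β) : b ≤ c :=
  h.le_or_le.resolve_right fun h' => hc (hβ h' hb)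

namespace RookExtension

variable {α β γ : Set (ℕ × ℕ)}

theorem refl (h : IsLowerSet α) : RookExtension α α :=
  ⟨h, h, subset_rfl, fun hb hc hbc => absurd (h hbc hc) hb⟩

/-- Two consecutive rook strips contain no chain of three boxes, so comparable boxes of them are
adjacent. -/
theorem adjacent_of_le (h₁ : RookExtension α β) (h₂ : RookExtension β γ) {b c : ℕ × ℕ}
    (hbα : b ∉ α) (hbβ : b ∈ β) (hcβ : c ∉ β) (hcγ : c ∈ γ) (hbc : b ≤ c) : Adjacent b c := by
  have key : ∀ x : ℕ × ℕ, b ≤ x → x ≤ c → x = b ∨ x = c := by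
    intro x hbx hxc
    by_cases hx : x ∈ β
    · exact Or.inl (h₁.eq_of_le hbα hx hbx).symm
    · exact Or.inr (h₂.eq_of_le hx hcγ hxc)
  have hne : b ≠ c := fun h => hcβ (h ▸ hbβ)
  obtain ⟨b₁, b₂⟩ := b
  obtain ⟨c₁, c₂⟩ := c
  have k₁ := key (b₁ + 1, b₂)
  have k₂ := key (b₁, b₂ + 1)
  simp only [Prod.mk_le_mk, Prod.mk.injEq, ne_eq, Adjacent] at *
  omega

/-- Boxes of the same rook strip are not adjacent. -/
theorem notMem_of_adjacent (h₁ : RookExtension α β) {b c : ℕ × ℕ}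
    (hbα : b ∉ α) (hbβ : b ∈ β) (hcα : c ∉ α) (hbc : Adjacent b c) : c ∉ β := by
  intro hcβ
  rcases hbc.le_or_le with h | h
  · exact hbc.ne (h₁.eq_of_le hbα hcβ h)
  · exact hbc.ne (h₁.eq_of_le hcα hbβ h).symm

theorem subset_switchShape (h₁ : RookExtension α β) (h₂ : RookExtension β γ) :
    α ⊆ switchShape α β γ :=
  fun _ hb => ⟨h₂.subset (h₁.subset hb), Or.inl hb⟩

theorem isLowerSet_switchShape (h₁ : RookExtension α β) (h₂ : RookExtension β γ) :
    IsLowerSet (switchShape α β γ) := by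
  intro b c hcb hb
  by_cases hcα : c ∈ α
  · exact subset_switchShape h₁ h₂ hcα
  obtain ⟨hbγ, hb | ⟨hbβ, -⟩ | ⟨hbβ, hadj⟩⟩ := id hb
  · exact absurd (h₁.isLowerSet_left hcb hb) hcα
  · rwa [h₁.eq_of_le hcα hbβ hcb]
  · by_cases hcβ : c ∈ β
    · exact absurd (h₁.adjacent_of_le h₂ hcα hcβ hbβ hbγ hcb).symm (hadj c hcβ hcα)
    · rwa [h₂.eq_of_le hcβ hbγ hcb]

theorem switchShape_left (h₁ : RookExtension α β) (h₂ : RookExtension β γ) :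
    RookExtension α (switchShape α β γ) where
  isLowerSet_left := h₁.isLowerSet_left
  isLowerSet_right := isLowerSet_switchShape h₁ h₂
  subset := subset_switchShape h₁ h₂
  eq_of_le := by
    intro b c hbα hc hbc
    obtain ⟨hcγ, hcα | ⟨hcβ, -⟩ | ⟨hcβ, hadj⟩⟩ := hc
    · exact absurd (h₁.isLowerSet_left hbc hcα) hbα
    · exact h₁.eq_of_le hbα hcβ hbc
    · by_cases hbβ : b ∈ β
      · exact absurd (h₁.adjacent_of_le h₂ hbα hbβ hcβ hcγ hbc).symm (hadj b hbβ hbα)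
      · exact h₂.eq_of_le hbβ hcγ hbc

theorem switchShape_right (h₁ : RookExtension α β) (h₂ : RookExtension β γ) :
    RookExtension (switchShape α β γ) γ where
  isLowerSet_left := isLowerSet_switchShape h₁ h₂
  isLowerSet_right := h₂.isLowerSet_right
  subset := fun _ hb => hb.1
  eq_of_le := by
    intro b c hb hcγ hbc
    have hbα : b ∉ α := fun h => hb (subset_switchShape h₁ h₂ h)
    by_cases hbβ : b ∈ β
    · by_cases hcβ : c ∈ β
      · exact h₁.eq_of_le hbα hcβ hbc
      · exact absurd ⟨h₂.isLowerSet_right hbc hcγ, Or.inr (Or.inl ⟨hbβ, c, hcγ, hcβ,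
          h₁.adjacent_of_le h₂ hbα hbβ hcβ hcγ hbc⟩)⟩ hb
    · exact h₂.eq_of_le hbβ hcγ hbc

end RookExtension

/-- The local rule commutes with the restriction to the first `m` columns, if all `•` lie there. -/
theorem switchShape_inter_columns {α β γ : Set (ℕ × ℕ)} (h₁ : RookExtension α β)
    {m : ℕ} (hm : ∀ b ∈ γ, b ∉ β → b.2 < m) :
    switchShape (α ∩ {b | b.2 < m}) (β ∩ {b | b.2 < m}) (γ ∩ {b | b.2 < m}) =
      switchShape α β γ ∩ {b | b.2 < m} := by
  ext b
  by_cases hb : b.2 < m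
  · have e₁ : (∃ c, (c ∈ γ ∧ c.2 < m) ∧ ¬ (c ∈ β ∧ c.2 < m) ∧ Adjacent b c) ↔
        ∃ c ∈ γ, c ∉ β ∧ Adjacent b c := by
      constructor
      · rintro ⟨c, ⟨h, h'⟩, h'', h'''⟩
        exact ⟨c, h, fun hc => h'' ⟨hc, h'⟩, h'''⟩
      · rintro ⟨c, h, h', h''⟩
        exact ⟨c, ⟨h, hm c h h'⟩, fun hc => h' hc.1, h''⟩
    have e₂ : b ∉ β → ((∀ c, (c ∈ β ∧ c.2 < m) → ¬ (c ∈ α ∧ c.2 < m) → ¬ Adjacent b c) ↔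
        ∀ c ∈ β, c ∉ α → ¬ Adjacent b c) := by
      intro hbβ
      constructor
      · intro h c hc hcα hadj
        have hcb : c ≤ b := hadj.symm.le_of_mem h₁.isLowerSet_right hc hbβ
        exact h c ⟨hc, lt_of_le_of_lt hcb.2 hb⟩ (fun hc' => hcα hc'.1) hadj
      · intro h c hc hcα hadj
        exact h c hc.1 (fun hc' => hcα ⟨hc', hc.2⟩) hadj
    simp only [switchShape, Set.mem_ofPred_eq, Set.mem_inter_iff, hb, and_true, e₁]
    by_cases hbβ : b ∈ β
    · simp [hbβ]
    · simp only [hbβ, false_and, not_false_eq_true, true_and, false_or, e₂ hbβ]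
  · simp [switchShape, hb]

/-- The local rule does not move `•` to the right. -/
theorem lt_of_mem_switchShape {α β γ : Set (ℕ × ℕ)} (h₁ : RookExtension α β) {m : ℕ}
    (hm : ∀ b ∈ γ, b ∉ β → b.2 < m) {b : ℕ × ℕ} (hb : b ∈ switchShape α β γ) (hbα : b ∉ α) :
    b.2 < m := by
  obtain ⟨hγ, h | ⟨hβ, c, hc, hcβ, hadj⟩ | ⟨hβ, -⟩⟩ := hb
  · exact absurd h hbα
  · exact lt_of_le_of_lt (hadj.le_of_mem h₁.isLowerSet_right hβ hcβ).2 (hm c hc hcβ)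
  · exact hm b hγ hβ

/-- A label that occurs in column `0` after a switch occurred there before the switch. -/
theorem exists_mem_column_zero_of_switchShape {α β γ : Set (ℕ × ℕ)} (h₁ : RookExtension α β)
    (h₂ : RookExtension β γ) {r : ℕ} (hr : (r, 0) ∈ γ) (hr' : (r, 0) ∉ switchShape α β γ) :
    ∃ s, (s, 0) ∈ β ∧ (s, 0) ∉ α := by
  by_cases hβ : (r, 0) ∈ β
  · exact ⟨r, hβ, fun h => hr' (h₁.subset_switchShape h₂ h)⟩
  · by_contra! hno
    refine hr' ⟨hr, Or.inr (Or.inr ⟨hβ, ?_⟩)⟩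
    rintro ⟨s, t⟩ hc hcα hadj
    have ht : t = 0 := Nat.le_zero.1 (hadj.symm.le_of_mem h₁.isLowerSet_right hc hβ).2
    subst ht
    exact hcα (hno s hc)

/-! ### Slides as growth diagrams -/

/-- An increasing tableau with labels in `{1, …, M}`, encoded by the order ideals `A k` of the boxes
that lie in the inner shape or carry a label `≤ k`; `A k` is the outer shape for `k ≥ M`. -/
structure IsTableauChain (M : ℕ) (A : ℕ → Set (ℕ × ℕ)) : Prop where
  step : ∀ k, RookExtension (A k) (A (k + 1))
  stable : ∀ k, M ≤ k → A k = A M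

theorem IsTableauChain.monotone {M : ℕ} {A : ℕ → Set (ℕ × ℕ)} (h : IsTableauChain M A) :
    Monotone A :=
  monotone_nat_of_le_succ fun k => (h.step k).subset

/-- The chain of the tableau after a slide which adds boxes to the outer shape so that it becomes
`ν`. It is computed by the local rule, from the largest label downwards. -/
def slideChain (M : ℕ) (A : ℕ → Set (ℕ × ℕ)) (ν : Set (ℕ × ℕ)) (k : ℕ) : Set (ℕ × ℕ) :=
  if k < M then switchShape (A k) (A (k + 1)) (slideChain M A ν (k + 1)) else ν
termination_by M - k

theorem slideChain_of_lt {M k : ℕ} (A : ℕ → Set (ℕ × ℕ)) (ν : Set (ℕ × ℕ)) (hk : k < M) :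
    slideChain M A ν k = switchShape (A k) (A (k + 1)) (slideChain M A ν (k + 1)) := by
  rw [slideChain, if_pos hk]

theorem slideChain_of_le {M k : ℕ} (A : ℕ → Set (ℕ × ℕ)) (ν : Set (ℕ × ℕ)) (hk : M ≤ k) :
    slideChain M A ν k = ν := by
  rw [slideChain, if_neg hk.not_gt]

section

variable {M : ℕ} {A : ℕ → Set (ℕ × ℕ)} {ν : Set (ℕ × ℕ)}

theorem IsTableauChain.rookExtension_slideChain (hA : IsTableauChain M A)
    (hν : RookExtension (A M) ν) (k : ℕ) : RookExtension (A k) (slideChain M A ν k) := by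
  rcases le_total M k with hk | hk
  · rwa [slideChain_of_le A ν hk, hA.stable k hk]
  · induction hk using Nat.decreasingInduction with
    | self => rwa [slideChain_of_le A ν le_rfl]
    | of_succ k hk ih =>
      rw [slideChain_of_lt A ν hk]
      exact (hA.step k).switchShape_left ih

theorem IsTableauChain.slideChain (hA : IsTableauChain M A) (hν : RookExtension (A M) ν) :
    IsTableauChain M (slideChain M A ν) where
  step k := by
    rcases lt_or_ge k M with hk | hk
    · rw [slideChain_of_lt A ν hk]
      exact (hA.step k).switchShape_right (hA.rookExtension_slideChain hν (k + 1))
    · rw [slideChain_of_le A ν hk, slideChain_of_le A ν (hk.trans k.le_succ)]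
      exact RookExtension.refl hν.isLowerSet_right
  stable k hk := by rw [slideChain_of_le A ν hk, slideChain_of_le A ν le_rfl]

end

/-- The filling in the middle of a slide, when the labels larger than `k` have been switched: the
labels `≤ k` are still those of the chain `A`, the labels `> k` are already those of the chain `B`,
and `•` fills `B k \ A k`. -/
structure EncodesPartialSlide (F : Filling) (k : ℕ) (A B : ℕ → Set (ℕ × ℕ)) : Prop where
  label_iff : ∀ b i, F b = Cell.label i ↔ ∃ j, i = j + 1 ∧
    ((j < k ∧ b ∈ A (j + 1) ∧ b ∉ A j) ∨ (k ≤ j ∧ b ∈ B (j + 1) ∧ b ∉ B j))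
  bullet_iff : ∀ b, F b = Cell.bullet ↔ b ∈ B k ∧ b ∉ A k

theorem EncodesPartialSlide.switch {F : Filling} {k : ℕ} {A B : ℕ → Set (ℕ × ℕ)}
    (h : EncodesPartialSlide F (k + 1) A B) (hA : Monotone A) (hB : Monotone B)
    (h₁ : RookExtension (A k) (A (k + 1))) (h₂ : RookExtension (A (k + 1)) (B (k + 1)))
    (hBk : B k = switchShape (A k) (A (k + 1)) (B (k + 1))) :
    EncodesPartialSlide (switch (k + 1) F) k A B := by
  have hlab : ∀ b, F b = Cell.label (k + 1) ↔ b ∈ A (k + 1) ∧ b ∉ A k := by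
    intro b
    rw [h.label_iff]
    constructor
    · rintro ⟨j, hj, ⟨-, hb⟩ | ⟨hk, -⟩⟩
      · obtain rfl : k = j := by omega
        exact hb
      · omega
    · exact fun hb => ⟨k, rfl, Or.inl ⟨k.lt_succ_self, hb⟩⟩
  have hrib : ∀ b, b ∈ ribbon (k + 1) F ↔ b ∈ B (k + 1) ∧ b ∉ A k := by
    intro b
    have : b ∈ ribbon (k + 1) F ↔ F b = Cell.bullet ∨ F b = Cell.label (k + 1) := Iff.rfl
    rw [this, hlab, h.bullet_iff]
    have h₃ := @h₁.subset b
    have h₄ := @h₂.subset b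
    tauto
  have hAB : A k ⊆ B k := hBk ▸ h₁.subset_switchShape h₂
  have hBB : B k ⊆ B (k + 1) := hB k.le_succ
  -- The boxes of the ribbon that carry `•` after the switch are those of the new strip.
  have hsw : ∀ b, b ∈ B (k + 1) → b ∉ A k →
      (b ∈ B k → KJdt.switch (k + 1) F b = Cell.bullet) ∧
      (b ∉ B k → KJdt.switch (k + 1) F b = Cell.label (k + 1)) := by
    intro b hbγ hbα
    have hcomp : InNonsingletonComponent (ribbon (k + 1) F) b ↔
        ∃ c, (c ∈ B (k + 1) ∧ c ∉ A k) ∧ Adjacent b c := by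
      simp only [inNonsingletonComponent_iff, hrib, hbγ, hbα, not_false_eq_true, and_self,
        true_and]
    by_cases hbβ : b ∈ A (k + 1)
    · have hF : F b = Cell.label (k + 1) := (hlab b).2 ⟨hbβ, hbα⟩
      have hmem : b ∈ B k ↔ InNonsingletonComponent (ribbon (k + 1) F) b := by
        rw [hcomp, hBk]
        constructor
        · rintro ⟨-, hb | ⟨-, c, hc, hcβ, hadj⟩ | ⟨hb, -⟩⟩
          · exact absurd hb hbα
          · exact ⟨c, ⟨hc, fun hcα => hcβ (h₁.subset hcα)⟩, hadj⟩
          · exact absurd hbβ hb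
        · rintro ⟨c, ⟨hc, hcα⟩, hadj⟩
          exact ⟨hbγ, Or.inr (Or.inl ⟨hbβ, c, hc,
            h₁.notMem_of_adjacent hbα hbβ hcα hadj, hadj⟩)⟩
      constructor <;> intro hb
      · simp only [KJdt.switch, if_pos (hmem.1 hb), hF, Cell.other]
      · simp only [KJdt.switch, if_neg (mt hmem.2 hb), hF]
    · have hF : F b = Cell.bullet := (h.bullet_iff b).2 ⟨hbγ, hbβ⟩
      have hmem : b ∉ B k ↔ InNonsingletonComponent (ribbon (k + 1) F) b := by
        rw [hcomp, hBk, not_iff_comm]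
        constructor
        · intro hno
          exact ⟨hbγ, Or.inr (Or.inr ⟨hbβ, fun c hc hcα hadj =>
            hno ⟨c, ⟨h₂.subset hc, hcα⟩, hadj⟩⟩)⟩
        · rintro ⟨-, hb | ⟨hb, -⟩ | ⟨-, hno⟩⟩
          · exact absurd hb hbα
          · exact absurd hb hbβ
          · rintro ⟨c, ⟨hc, hcα⟩, hadj⟩
            by_cases hcβ : c ∈ A (k + 1)
            · exact hno c hcβ hcα hadj
            · exact h₂.notMem_of_adjacent hbβ hbγ hcβ hadj hc
      constructor <;> intro hb
      · simp only [KJdt.switch, if_neg (mt hmem.2 (not_not.2 hb)), hF]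
      · simp only [KJdt.switch, if_pos (hmem.1 hb), hF, Cell.other]
  have hout : ∀ b, ¬ (b ∈ B (k + 1) ∧ b ∉ A k) → KJdt.switch (k + 1) F b = F b := by
    intro b hb
    have : ¬ InNonsingletonComponent (ribbon (k + 1) F) b := by
      rw [inNonsingletonComponent_iff, hrib]
      exact fun h' => hb h'.1
    simp only [KJdt.switch, if_neg this]
  -- Outside the ribbon nothing changes, and no box there has the label `k + 1`.
  constructor
  · intro b i
    by_cases hb : b ∈ B (k + 1) ∧ b ∉ A k
    · have hlow : ∀ j < k, b ∉ A (j + 1) := fun j hj hbj => hb.2 (hA hj hbj)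
      have hhigh : ∀ j, k < j → b ∈ B j := fun j hj => hB hj hb.1
      by_cases hbk : b ∈ B k
      · rw [(hsw b hb.1 hb.2).1 hbk]
        constructor
        · intro h'; cases h'
        · rintro ⟨j, -, ⟨hj, hbj, -⟩ | ⟨hj, -, hbj⟩⟩
          · exact absurd hbj (hlow j hj)
          · exact absurd (hB hj hbk) hbj
      · rw [(hsw b hb.1 hb.2).2 hbk]
        constructor
        · intro h'
          cases h'
          exact ⟨k, rfl, Or.inr ⟨le_rfl, hb.1, hbk⟩⟩
        · rintro ⟨j, hj', ⟨hj, hbj, -⟩ | ⟨hj, -, hbj⟩⟩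
          · exact absurd hbj (hlow j hj)
          · rcases hj.eq_or_lt with rfl | hj
            · rw [hj']
            · exact absurd (hhigh j hj) hbj
    · rw [hout b hb, h.label_iff]
      refine exists_congr fun j => and_congr_right fun _ => ?_
      rcases lt_trichotomy j k with hj | rfl | hj
      · simp [hj, hj.not_ge, hj.not_gt, Nat.lt_succ_of_lt hj]
      · have h₃ := @h₁.subset b
        have h₄ := @h₂.subset b
        have h₅ := @hAB b
        simp only [lt_irrefl, Nat.lt_succ_self, le_refl, Nat.not_succ_le_self]
        tauto
      · simp [hj.not_gt, hj.le, Nat.succ_le_of_lt hj, Nat.not_lt.2 (Nat.succ_le_of_lt hj)]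
  · intro b
    by_cases hb : b ∈ B (k + 1) ∧ b ∉ A k
    · by_cases hbk : b ∈ B k
      · simp [(hsw b hb.1 hb.2).1 hbk, hbk, hb.2]
      · simp [(hsw b hb.1 hb.2).2 hbk, hbk]
    · rw [hout b hb, h.bullet_iff]
      have h₃ := @h₁.subset b
      have h₄ := @hBB b
      tauto

/-- Carrying out the switches for the labels `k, …, 1` follows the local rule. -/
theorem EncodesPartialSlide.switchDown {M : ℕ} {A : ℕ → Set (ℕ × ℕ)} {ν : Set (ℕ × ℕ)}
    (hA : IsTableauChain M A) (hν : RookExtension (A M) ν) :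
    ∀ {k : ℕ} {F : Filling}, k ≤ M → EncodesPartialSlide F k A (slideChain M A ν) →
      EncodesPartialSlide (switchDown k F) 0 A (slideChain M A ν)
  | 0, _, _, h => h
  | k + 1, _, hk, h =>
    EncodesPartialSlide.switchDown hA hν (k := k) (Nat.le_of_succ_le hk)
      (h.switch hA.monotone (hA.slideChain hν).monotone (hA.step k)
        (hA.rookExtension_slideChain hν (k + 1)) (slideChain_of_lt A ν hk))

/-- The switch for a label that does not occur does nothing if there is at most one `•`. -/
theorem switch_eq_self {F : Filling} {i : ℕ} (hi : ∀ b, F b ≠ Cell.label i)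
    (hF : ∀ b c, F b = Cell.bullet → F c = Cell.bullet → b = c) : switch i F = F := by
  funext b
  have : ¬ InNonsingletonComponent (ribbon i F) b := by
    rw [inNonsingletonComponent_iff]
    rintro ⟨hb, c, hc, hadj⟩
    exact hadj.ne (hF b c (hb.resolve_right (hi b)) (hc.resolve_right (hi c)))
  simp only [switch, if_neg this]

/-- One may start the switches at any upper bound of the labels. -/
theorem switchDown_eq_of_le {F : Filling} {m M : ℕ} (hmM : m ≤ M)
    (hm : ∀ b i, F b = Cell.label i → i ≤ m)
    (hF : ∀ b c, F b = Cell.bullet → F c = Cell.bullet → b = c) :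
    switchDown M F = switchDown m F := by
  induction M, hmM using Nat.le_induction with
  | base => rfl
  | succ M hM ih =>
    rw [switchDown, switch_eq_self (fun b hb => by have := hm b _ hb; omega) hF, ih]

/-- The tableau `T` is the one that is encoded by the chain `A`. -/
structure SkewFilling.IsEncodedBy (T : SkewFilling) (M : ℕ) (A : ℕ → Set (ℕ × ℕ)) : Prop where
  isTableauChain : IsTableauChain M A
  outer_eq : A M = (T.outer : Set (ℕ × ℕ))
  label_iff : ∀ b i, T.fill b = Cell.label i ↔ ∃ j, i = j + 1 ∧ b ∈ A (j + 1) ∧ b ∉ A j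
  ne_bullet : ∀ b, T.fill b ≠ Cell.bullet

theorem IsTableauChain.lt_of_mem {M : ℕ} {A : ℕ → Set (ℕ × ℕ)} (h : IsTableauChain M A) {b : ℕ × ℕ} {j : ℕ} (hb : b ∈ A (j + 1))
    (hb' : b ∉ A j) : j < M := by
  by_contra! hj
  rw [h.stable _ (hj.trans j.le_succ), ← h.stable j hj] at hb
  exact hb' hb

namespace SkewFilling.IsEncodedBy

variable {T : SkewFilling} {M : ℕ} {A : ℕ → Set (ℕ × ℕ)}

theorem mem_outer (h : T.IsEncodedBy M A) {b : ℕ × ℕ} {j : ℕ} (hb : b ∈ A j) : b ∈ T.outer := by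
  have : b ∈ A M := by
    rcases le_total M j with hj | hj
    · rwa [← h.isTableauChain.stable j hj]
    · exact h.isTableauChain.monotone hj hb
  rwa [h.outer_eq] at this

theorem label_le_maxLabel (h : T.IsEncodedBy M A) {b : ℕ × ℕ} {i : ℕ}
    (hb : T.fill b = Cell.label i) : i ≤ T.maxLabel := by
  obtain ⟨j, -, hj, -⟩ := (h.label_iff b i).1 hb
  have := Finset.le_sup (f := fun b => (T.fill b).value) (h.mem_outer hj)
  rwa [hb] at this

theorem maxLabel_le (h : T.IsEncodedBy M A) : T.maxLabel ≤ M := by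
  refine Finset.sup_le fun b _ => ?_
  cases hb : T.fill b with
  | blank => exact Nat.zero_le _
  | bullet => exact Nat.zero_le _
  | label i =>
    obtain ⟨j, rfl, hj, hj'⟩ := (h.label_iff b i).1 hb
    exact h.isTableauChain.lt_of_mem hj hj'

/-- A slide into at most one box, in terms of the chains of the tableaux. -/
theorem revKjdt (h : T.IsEncodedBy M A) {X : Finset (ℕ × ℕ)} (hX : ∀ b ∈ X, b ∉ T.outer)
    (hX₁ : ∀ b ∈ X, ∀ c ∈ X, b = c)
    (hν : RookExtension (A M) ((T.outer ∪ X : Finset (ℕ × ℕ)) : Set (ℕ × ℕ))) :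
    (KJdt.revKjdt X T).IsEncodedBy M
      (slideChain M A ((T.outer ∪ X : Finset (ℕ × ℕ)) : Set (ℕ × ℕ))) := by
  set ν : Set (ℕ × ℕ) := ((T.outer ∪ X : Finset (ℕ × ℕ)) : Set (ℕ × ℕ)) with hνdef
  have hA := h.isTableauChain
  have hF : ∀ b, placeBullets X T.fill b = Cell.bullet ↔ b ∈ X := by
    intro b
    by_cases hb : b ∈ X <;> simp [placeBullets, hb, h.ne_bullet]
  have hFl : ∀ b i, placeBullets X T.fill b = Cell.label i ↔ T.fill b = Cell.label i := by
    intro b i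
    by_cases hb : b ∈ X
    · have : T.fill b ≠ Cell.label i := by
        intro hb'
        obtain ⟨j, -, hj, -⟩ := (h.label_iff b i).1 hb'
        exact hX b hb (h.mem_outer hj)
      simp [placeBullets, hb, this]
    · simp [placeBullets, hb]
  have h₀ : EncodesPartialSlide (placeBullets X T.fill) M A (slideChain M A ν) := by
    constructor
    · intro b i
      rw [hFl, h.label_iff]
      refine exists_congr fun j => and_congr_right fun _ => ?_
      constructor
      · exact fun hb => Or.inl ⟨hA.lt_of_mem hb.1 hb.2, hb⟩
      · rintro (⟨-, hb⟩ | ⟨hj, hb, hb'⟩)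
        · exact hb
        · rw [slideChain_of_le _ _ (hj.trans j.le_succ)] at hb
          rw [slideChain_of_le _ _ hj] at hb'
          exact absurd hb hb'
    · intro b
      rw [hF, slideChain_of_le _ _ le_rfl, h.outer_eq, hνdef]
      simp only [Finset.coe_union, Set.mem_union, Finset.mem_coe]
      constructor
      · exact fun hb => ⟨Or.inr hb, hX b hb⟩
      · exact fun hb => hb.1.resolve_left hb.2
  have h₁ := EncodesPartialSlide.switchDown hA hν le_rfl h₀
  rw [switchDown_eq_of_le h.maxLabel_le
    (fun b i hb => h.label_le_maxLabel ((hFl b i).1 hb))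
    (fun b c hb hc => hX₁ b ((hF b).1 hb) c ((hF c).1 hc))] at h₁
  refine ⟨hA.slideChain hν, slideChain_of_le _ _ le_rfl, fun b i => ?_, fun b => ?_⟩
  · have e : (KJdt.revKjdt X T).fill b = Cell.label i ↔
        KJdt.switchDown T.maxLabel (placeBullets X T.fill) b = Cell.label i := by
      simp only [KJdt.revKjdt, eraseBullets]
      cases KJdt.switchDown T.maxLabel (placeBullets X T.fill) b <;> simp
    rw [e, h₁.label_iff]
    simp
  · simp only [KJdt.revKjdt, eraseBullets]
    cases KJdt.switchDown T.maxLabel (placeBullets X T.fill) b <;> simp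

end SkewFilling.IsEncodedBy

/-! ### Decreasing subsequences of the reading word -/

/-- `Q r v` means that the label `v` occurs in row `r` of a tableau. The row reading word (rows from
bottom to top) then has a strictly decreasing subsequence of length `d`: there are `d` labels in
different rows which increase from top to bottom. The subsequence is given as a set of pairs
`(row, label)`. -/
def HasDecreasing (Q : ℕ → ℕ → Prop) (d : ℕ) : Prop :=
  ∃ S : Finset (ℕ × ℕ), S.card = d ∧ (∀ p ∈ S, Q p.1 p.2) ∧
    ∀ p ∈ S, ∀ q ∈ S, p ≠ q → (p.1 < q.1 ∧ p.2 < q.2) ∨ (q.1 < p.1 ∧ q.2 < p.2)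

/-- Two tableaux differ only in the rows of the label `w`. If `w` has left row `r` for an adjacent
row `s`, and any label of row `s` that would conflict with `w` there can be accompanied by a
substitute for `w` in row `r`, then decreasing subsequences of the first tableau yield ones of the
same length of the second. -/
theorem HasDecreasing.exchange {Q Q' : ℕ → ℕ → Prop} {w d : ℕ}
    (same : ∀ r v, v ≠ w → Q r v → Q' r v)
    (moved : ∀ r, Q r w → Q' r w ∨ ∃ s, Q' s w ∧
      ((r = s + 1 ∧ ∀ v < w, Q s v → ∃ v', v < v' ∧ v' < w ∧ Q r v') ∨
        (s = r + 1 ∧ ∀ v > w, Q s v → ∃ v', w < v' ∧ v' < v ∧ Q r v')))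
    (h : HasDecreasing Q d) : HasDecreasing Q' d := by
  obtain ⟨S, hcard, hS, hchain⟩ := h
  by_cases hw : ∃ r, (r, w) ∈ S ∧ ¬ Q' r w
  · obtain ⟨r, hr, hr'⟩ := hw
    have hne : ∀ q ∈ S, q ≠ (r, w) → q.2 ≠ w := by
      intro q hq hqr
      have := hchain q hq _ hr hqr
      dsimp only at this
      omega
    have replace : ∀ p : ℕ × ℕ, Q' p.1 p.2 →
        (∀ q ∈ S, q ≠ (r, w) → (p.1 < q.1 ∧ p.2 < q.2) ∨ (q.1 < p.1 ∧ q.2 < p.2)) →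
        HasDecreasing Q' d := by
      intro p hp hcomp
      have hpS : p ∉ S.erase (r, w) := by
        intro hp'
        have := hcomp p (Finset.mem_of_mem_erase hp') (Finset.ne_of_mem_erase hp')
        omega
      refine ⟨insert p (S.erase (r, w)), ?_, ?_, ?_⟩
      · rw [Finset.card_insert_of_notMem hpS, Finset.card_erase_add_one hr, hcard]
      · intro q hq
        rcases Finset.mem_insert.1 hq with rfl | hq
        · exact hp
        · have hqS := Finset.mem_of_mem_erase hq
          exact same _ _ (hne q hqS (Finset.ne_of_mem_erase hq)) (hS q hqS)
      · intro q hq q' hq' hqq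
        rcases Finset.mem_insert.1 hq with e | e <;> rcases Finset.mem_insert.1 hq' with e' | e'
        · exact absurd (e.trans e'.symm) hqq
        · exact e ▸ hcomp q' (Finset.mem_of_mem_erase e') (Finset.ne_of_mem_erase e')
        · exact e' ▸ (hcomp q (Finset.mem_of_mem_erase e) (Finset.ne_of_mem_erase e)).symm
        · exact hchain q (Finset.mem_of_mem_erase e) q' (Finset.mem_of_mem_erase e') hqq
    obtain ⟨s, hs, ⟨rfl, hsub⟩ | ⟨rfl, hsub⟩⟩ := (moved r (hS _ hr)).resolve_left hr'
    · by_cases hv : ∃ v, (s, v) ∈ S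
      · obtain ⟨v, hv⟩ := hv
        have hvw := hchain _ hv _ hr (by simp)
        obtain ⟨v', h₁, h₂, h₃⟩ := hsub v (by dsimp only at hvw; omega) (hS _ hv)
        refine replace (s + 1, v') (same _ _ h₂.ne h₃) fun q hq hqr => ?_
        have h₄ := hchain q hq _ hr hqr
        by_cases hqv : q = (s, v)
        · subst hqv; dsimp only at *; omega
        · have h₅ := hchain q hq _ hv hqv
          dsimp only at *; omega
      · refine replace (s, w) hs fun q hq hqr => ?_
        have h₄ := hchain q hq _ hr hqr
        have h₅ : q.1 ≠ s := fun h => hv ⟨q.2, h ▸ hq⟩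
        dsimp only at *; omega
    · by_cases hv : ∃ v, (r + 1, v) ∈ S
      · obtain ⟨v, hv⟩ := hv
        have hvw := hchain _ hv _ hr (by simp)
        obtain ⟨v', h₁, h₂, h₃⟩ := hsub v (by dsimp only at hvw; omega) (hS _ hv)
        refine replace (r, v') (same _ _ h₁.ne' h₃) fun q hq hqr => ?_
        have h₄ := hchain q hq _ hr hqr
        by_cases hqv : q = (r + 1, v)
        · subst hqv; dsimp only at *; omega
        · have h₅ := hchain q hq _ hv hqv
          dsimp only at *; omega
      · refine replace (r + 1, w) hs fun q hq hqr => ?_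
        have h₄ := hchain q hq _ hr hqr
        have h₅ : q.1 ≠ r + 1 := fun h => hv ⟨q.2, h ▸ hq⟩
        dsimp only at *; omega
  · push Not at hw
    refine ⟨S, hcard, fun p hp => ?_, hchain⟩
    by_cases hpw : p.2 = w
    · obtain ⟨r, v⟩ := p
      obtain rfl : v = w := hpw
      exact hw r hp
    · exact same _ _ hpw (hS p hp)

/-- A growth diagram: `G u k` consists of the boxes that are empty or have a label `≤ k`, after `u`
slides. For each `u` the sets `G u k` form the chain of a tableau with labels `≤ M`; for each `k`
the sets `G u k` form the chain of a tableau whose labels number the slides. -/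
structure IsGrowthDiagram (M : ℕ) (G : ℕ → ℕ → Set (ℕ × ℕ)) : Prop where
  isTableauChain : ∀ u, IsTableauChain M (G u)
  rookExtension : ∀ u k, RookExtension (G u k) (G (u + 1) k)
  rule : ∀ u, ∀ k < M, G (u + 1) k = switchShape (G u k) (G u (k + 1)) (G (u + 1) (k + 1))

/-- In a growth diagram, the slide number `v` (counted from `0`, and among the first `N` slides)
occurs in row `r` of the tableau of slide numbers at height `k`. -/
def SlideInRow (G : ℕ → ℕ → Set (ℕ × ℕ)) (N k r v : ℕ) : Prop :=
  v < N ∧ ∃ c, (r, c) ∈ G (v + 1) k ∧ (r, c) ∉ G v k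

/-- As `SlideInRow`, where the slide numbers `< u` are those at height `k` and the others are those
at height `k + 1`. -/
def MixedSlideInRow (G : ℕ → ℕ → Set (ℕ × ℕ)) (N k u r v : ℕ) : Prop :=
  SlideInRow G N (if v < u then k else k + 1) r v

theorem exists_first_entry {A : ℕ → Set (ℕ × ℕ)} {b : ℕ × ℕ} {m n : ℕ} (hm : b ∉ A m)
    (hn : b ∈ A n) (hmn : m ≤ n) : ∃ v, m ≤ v ∧ v < n ∧ b ∈ A (v + 1) ∧ b ∉ A v := by
  induction n, hmn using Nat.le_induction with
  | base => exact absurd hn hm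
  | succ n hmn ih =>
    by_cases h : b ∈ A n
    · obtain ⟨v, h₁, h₂, h₃⟩ := ih h
      exact ⟨v, h₁, h₂.trans n.lt_succ_self, h₃⟩
    · exact ⟨n, hmn, n.lt_succ_self, hn, h⟩

namespace IsGrowthDiagram

variable {M : ℕ} {G : ℕ → ℕ → Set (ℕ × ℕ)}

theorem monotone (hG : IsGrowthDiagram M G) (k : ℕ) : Monotone fun u => G u k :=
  monotone_nat_of_le_succ fun u => (hG.rookExtension u k).subset

/-- One switch preserves the lengths of decreasing subsequences of the tableau of slide numbers. -/
theorem hasDecreasing_mixed_succ (hG : IsGrowthDiagram M G) {N k u d : ℕ} (hk : k < M) :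
    HasDecreasing (MixedSlideInRow G N k u) d ↔ HasDecreasing (MixedSlideInRow G N k (u + 1)) d := by
  have same : ∀ r v, v ≠ u → (MixedSlideInRow G N k u r v ↔ MixedSlideInRow G N k (u + 1) r v) := by
    intro r v hv
    have : v < u ↔ v < u + 1 := by omega
    simp only [MixedSlideInRow, this]
  have hα : ∀ r v, v < u → (MixedSlideInRow G N k u r v ↔ SlideInRow G N k r v) :=
    fun r v hv => by simp [MixedSlideInRow, hv]
  have hβ : ∀ r, MixedSlideInRow G N k u r u ↔ SlideInRow G N (k + 1) r u :=
    fun r => by simp [MixedSlideInRow]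
  have hδ : ∀ r, MixedSlideInRow G N k (u + 1) r u ↔ SlideInRow G N k r u :=
    fun r => by simp [MixedSlideInRow]
  have hγ : ∀ r v, u < v → (MixedSlideInRow G N k (u + 1) r v ↔ SlideInRow G N (k + 1) r v) :=
    fun r v hv => by simp [MixedSlideInRow, Nat.not_lt.2 (Nat.succ_le_of_lt hv)]
  have h₁ := (hG.isTableauChain u).step k
  have h₂ := hG.rookExtension u (k + 1)
  have hrule := hG.rule u k hk
  constructor
  · refine HasDecreasing.exchange (w := u) (fun r v hv => (same r v hv).1) fun r hr => ?_
    rw [hβ] at hr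
    obtain ⟨huN, c, hcγ, hcβ⟩ := hr
    rw [or_iff_not_imp_left, hδ]
    intro hlost
    -- The slide number leaves row `r` only if the box above it holds the label `k + 1`.
    have hcδ : (r, c) ∉ G (u + 1) k := fun h => hlost ⟨huN, c, h, fun h' => hcβ (h₁.subset h')⟩
    obtain ⟨⟨s, t⟩, hK, hKα, hadj⟩ : ∃ b, b ∈ G u (k + 1) ∧ b ∉ G u k ∧ Adjacent (r, c) b := by
      by_contra! hno
      exact hcδ (hrule ▸ ⟨hcγ, Or.inr (Or.inr ⟨hcβ, hno⟩)⟩)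
    have hle := hadj.symm.le_of_mem h₁.isLowerSet_right hK hcβ
    have hKδ : (s, t) ∈ G (u + 1) k :=
      hrule ▸ ⟨h₂.subset hK, Or.inr (Or.inl ⟨hK, _, hcγ, hcβ, hadj.symm⟩)⟩
    have hsr : s ≠ r := fun h => hlost (h ▸ ⟨huN, t, hKδ, hKα⟩)
    simp only [Adjacent, Prod.mk_le_mk] at hadj hle
    obtain ⟨rfl, rfl⟩ : c = t ∧ r = s + 1 := by omega
    refine ⟨s, (hδ s).2 ⟨huN, c, hKδ, hKα⟩, Or.inl ⟨rfl, fun v hv hsv => ?_⟩⟩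
    -- A smaller slide number in row `s` stands above another one, still left of the box.
    rw [hα _ _ hv] at hsv
    obtain ⟨hvN, c', hc', hc''⟩ := hsv
    have hcc : c' < c := by
      by_contra! h
      exact hKα ((h₁.isLowerSet_left (Prod.mk_le_mk.2 ⟨le_rfl, h⟩)) (hG.monotone k hv hc'))
    have hnot : (s + 1, c') ∉ G (v + 1) k := by
      intro h
      have := (hG.rookExtension v k).eq_of_le hc'' h (Prod.mk_le_mk.2 ⟨s.le_succ, le_rfl⟩)
      simp at this
    have hleft : (s + 1, c - 1) ∈ G u (k + 1) := by
      by_contra h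
      have := h₂.eq_of_le h hcγ (Prod.mk_le_mk.2 ⟨le_rfl, Nat.sub_le _ _⟩)
      simp only [Prod.mk.injEq] at this
      omega
    have hleft' : (s + 1, c - 1) ∈ G u k := by
      by_contra h
      refine hlost ⟨huN, c - 1, hrule ▸ ⟨h₂.subset hleft,
        Or.inr (Or.inl ⟨hleft, _, hcγ, hcβ, ?_⟩)⟩, h⟩
      exact Or.inl ⟨rfl, Or.inl (Nat.sub_add_cancel (Nat.one_le_of_lt hcc))⟩
    have hin : (s + 1, c') ∈ G u k :=
      h₁.isLowerSet_left (Prod.mk_le_mk.2 ⟨le_rfl, by omega⟩) hleft'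
    obtain ⟨v', hv₁, hv₂, hv₃⟩ := exists_first_entry (A := fun u => G u k) hnot hin hv
    exact ⟨v', hv₁, hv₂, (hα _ _ hv₂).2 ⟨hv₂.trans huN, c', hv₃⟩⟩
  · refine HasDecreasing.exchange (w := u) (fun r v hv => (same r v hv).2) fun r hr => ?_
    rw [hδ] at hr
    obtain ⟨huN, c, hcδ, hcα⟩ := hr
    rw [or_iff_not_imp_left, hβ]
    intro hgain
    -- The slide number is new in row `r` only if it comes from the box below.
    obtain ⟨hcγ, h | ⟨hcβ, ⟨s, t⟩, hb, hbβ, hadj⟩ | ⟨hcβ, -⟩⟩ := (hrule ▸ hcδ :)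
    · exact absurd h hcα
    · have hle := hadj.le_of_mem h₁.isLowerSet_right hcβ hbβ
      have hsr : s ≠ r := fun h => hgain (h ▸ ⟨huN, t, hb, hbβ⟩)
      simp only [Adjacent, Prod.mk_le_mk] at hadj hle
      obtain ⟨rfl, rfl⟩ : t = c ∧ s = r + 1 := by omega
      refine ⟨r + 1, (hβ _).2 ⟨huN, t, hb, hbβ⟩, Or.inr ⟨rfl, fun v hv hsv => ?_⟩⟩
      -- A larger slide number in row `r + 1` stands below another one, still right of the box.
      rw [hγ _ _ hv] at hsv
      obtain ⟨hvN, c', hc', hc''⟩ := hsv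
      have hcc : t < c' := by
        by_contra! h
        exact hc'' (hG.monotone (k + 1) hv
          (h₂.isLowerSet_right (Prod.mk_le_mk.2 ⟨le_rfl, h⟩) hb))
      have hin : (r, c') ∈ G v (k + 1) := by
        by_contra h
        have := (hG.rookExtension v (k + 1)).eq_of_le h hc'
          (Prod.mk_le_mk.2 ⟨r.le_succ, le_rfl⟩)
        simp at this
      have hnot : (r, c') ∉ G (u + 1) (k + 1) := by
        intro h
        have h₃ : (r, t + 1) ∈ G (u + 1) (k + 1) :=
          h₂.isLowerSet_right (Prod.mk_le_mk.2 ⟨le_rfl, hcc⟩) h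
        have h₄ : (r, t + 1) ∈ G u (k + 1) := by
          by_contra h'
          exact hgain ⟨huN, _, h₃, h'⟩
        have := h₁.eq_of_le hcα h₄ (Prod.mk_le_mk.2 ⟨le_rfl, t.le_succ⟩)
        simp at this
      obtain ⟨v', hv₁, hv₂, hv₃⟩ := exists_first_entry (A := fun u => G u (k + 1)) hnot hin hv
      exact ⟨v', hv₁, hv₂, (hγ _ _ hv₁).2 ⟨hv₂.trans hvN, c', hv₃⟩⟩
    · exact absurd ⟨huN, c, hcγ, hcβ⟩ hgain

/-- The lengths of decreasing subsequences of the tableau of slide numbers do not depend on the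
height. -/
theorem hasDecreasing_iff (hG : IsGrowthDiagram M G) {N d : ℕ} :
    HasDecreasing (SlideInRow G N M) d ↔ HasDecreasing (SlideInRow G N 0) d := by
  have step : ∀ k < M, HasDecreasing (SlideInRow G N (k + 1)) d ↔
      HasDecreasing (SlideInRow G N k) d := by
    intro k hk
    have h₀ : MixedSlideInRow G N k 0 = SlideInRow G N (k + 1) := by
      funext r v; simp [MixedSlideInRow]
    have hN : MixedSlideInRow G N k N = SlideInRow G N k := by
      funext r v
      by_cases hv : v < N <;> simp [MixedSlideInRow, SlideInRow, hv]
    have : ∀ u, HasDecreasing (MixedSlideInRow G N k 0) d ↔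
        HasDecreasing (MixedSlideInRow G N k u) d := by
      intro u
      induction u with
      | zero => rfl
      | succ u ih => rw [ih, hG.hasDecreasing_mixed_succ hk]
    rw [← h₀, ← hN]
    exact this N
  have : ∀ k ≤ M, HasDecreasing (SlideInRow G N k) d ↔ HasDecreasing (SlideInRow G N 0) d := by
    intro k hk
    induction k with
    | zero => rfl
    | succ k ih => rw [step k hk, ih (Nat.le_of_succ_le hk)]
  exact this M le_rfl

/-- If the boxes of a column in the rows `a, …, a + d - 1` enter the order ideals at height `k` during
the first `N` slides, then their slide numbers form a decreasing subsequence of length `d`. -/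
theorem hasDecreasing_of_column (hG : IsGrowthDiagram M G) {N k a d c : ℕ}
    (h₀ : ∀ r, a ≤ r → (r, c) ∉ G 0 k) (hN : ∀ r, r < a + d → (r, c) ∈ G N k) :
    HasDecreasing (SlideInRow G N k) d := by
  have hex : ∀ r : Fin d, ∃ v, v < N ∧ (a + r, c) ∈ G (v + 1) k ∧ (a + r.1, c) ∉ G v k := by
    intro r
    obtain ⟨v, -, hv⟩ := exists_first_entry (A := fun u => G u k) (h₀ (a + r) (Nat.le_add_right _ _))
      (hN (a + r) (by omega)) (Nat.zero_le N)
    exact ⟨v, hv⟩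
  choose τ hτ using hex
  have hlt : ∀ i j : Fin d, i < j → τ i < τ j := by
    intro i j hij
    by_contra! h
    have h₁ := (hG.rookExtension (τ i) k).eq_of_le (hτ i).2.2
      (hG.monotone k (Nat.succ_le_succ h) (hτ j).2.1)
      (Prod.mk_le_mk.2 ⟨Nat.add_le_add_left (Fin.le_def.1 hij.le) a, le_rfl⟩)
    simp only [Prod.mk.injEq, and_true] at h₁
    omega
  refine ⟨Finset.univ.image fun i : Fin d => (a + i.1, τ i), ?_, ?_, ?_⟩
  · rw [Finset.card_image_of_injective, Finset.card_univ, Fintype.card_fin]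
    intro i j hij
    simp only [Prod.mk.injEq] at hij
    exact Fin.ext (by omega)
  · intro p hp
    obtain ⟨i, -, rfl⟩ := Finset.mem_image.1 hp
    exact ⟨(hτ i).1, c, (hτ i).2⟩
  · intro p hp q hq hpq
    obtain ⟨i, -, rfl⟩ := Finset.mem_image.1 hp
    obtain ⟨j, -, rfl⟩ := Finset.mem_image.1 hq
    rcases lt_trichotomy i j with h | rfl | h
    · exact Or.inl ⟨Nat.add_lt_add_left h a, hlt i j h⟩
    · exact absurd rfl hpq
    · exact Or.inr ⟨Nat.add_lt_add_left h a, hlt j i h⟩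

end IsGrowthDiagram

/-- A decreasing subsequence whose rows are at least `a` reaches row `a + d - 1`. -/
theorem HasDecreasing.exists_row {Q : ℕ → ℕ → Prop} {a d : ℕ} (h : HasDecreasing Q (d + 1))
    (hQ : ∀ r v, Q r v → a ≤ r) : ∃ r v, a + d ≤ r ∧ Q r v := by
  obtain ⟨S, hcard, hS, hchain⟩ := h
  by_contra! hno
  have hinj : Set.InjOn Prod.fst (S : Set (ℕ × ℕ)) := by
    intro p hp q hq hpq
    by_contra hne
    have := hchain p hp q hq hne
    omega
  have hsub : S.image Prod.fst ⊆ Finset.Ico a (a + d) := by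
    intro r hr
    obtain ⟨p, hp, rfl⟩ := Finset.mem_image.1 hr
    refine Finset.mem_Ico.2 ⟨hQ _ _ (hS p hp), ?_⟩
    by_contra! h
    exact hno _ _ h (hS p hp)
  have := Finset.card_le_card hsub
  rw [Finset.card_image_of_injOn hinj, hcard, Nat.card_Ico] at this
  omega

/-! ### The growth diagram of the reverse K-rectification -/

/-- The chains of the successive tableaux, when the outer shapes are `ν 0, ν 1, …`. -/
def growth (M : ℕ) (A : ℕ → Set (ℕ × ℕ)) (ν : ℕ → Set (ℕ × ℕ)) : ℕ → ℕ → Set (ℕ × ℕ)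
  | 0 => A
  | u + 1 => slideChain M (growth M A ν u) (ν (u + 1))

section

variable {M : ℕ} {A : ℕ → Set (ℕ × ℕ)} {ν : ℕ → Set (ℕ × ℕ)}

theorem growth_outer (h₀ : A M = ν 0) (u : ℕ) : growth M A ν u M = ν u := by
  cases u with
  | zero => exact h₀
  | succ u => exact slideChain_of_le _ _ le_rfl

theorem isTableauChain_growth (hA : IsTableauChain M A) (h₀ : A M = ν 0)
    (hν : ∀ u, RookExtension (ν u) (ν (u + 1))) (u : ℕ) : IsTableauChain M (growth M A ν u) := by
  induction u with
  | zero => exact hA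
  | succ u ih => exact ih.slideChain (by rw [growth_outer h₀]; exact hν u)

theorem isGrowthDiagram_growth (hA : IsTableauChain M A) (h₀ : A M = ν 0)
    (hν : ∀ u, RookExtension (ν u) (ν (u + 1))) : IsGrowthDiagram M (growth M A ν) where
  isTableauChain := isTableauChain_growth hA h₀ hν
  rookExtension u k := (isTableauChain_growth hA h₀ hν u).rookExtension_slideChain
    (by rw [growth_outer h₀]; exact hν u) k
  rule _ _ hk := slideChain_of_lt _ _ hk

end

/-- The outer shape after `u` slides into leftmost outer corners. -/
def outerAfter (Lam ν : Finset (ℕ × ℕ)) : ℕ → Finset (ℕ × ℕ)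
  | 0 => ν
  | u + 1 => outerAfter Lam ν u ∪ leftmostOuterCorner Lam (outerAfter Lam ν u)

section

variable {Lam ν : Finset (ℕ × ℕ)}

theorem mem_sdiff_of_mem_leftmostOuterCorner {b : ℕ × ℕ} (hb : b ∈ leftmostOuterCorner Lam ν) :
    b ∈ Lam \ ν :=
  (Finset.mem_filter.1 (Finset.mem_filter.1 hb).1).1

theorem rookExtension_union_leftmostOuterCorner (hLam : IsLowerSet (Lam : Set (ℕ × ℕ)))
    (hν : IsLowerSet (ν : Set (ℕ × ℕ))) :
    RookExtension (ν : Set (ℕ × ℕ)) ((ν ∪ leftmostOuterCorner Lam ν : Finset (ℕ × ℕ)) :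
      Set (ℕ × ℕ)) := by
  have key : ∀ b c, b ∉ ν → c ∈ ν ∪ leftmostOuterCorner Lam ν → b ≤ c → b = c := by
    intro b c hb hc hbc
    rcases Finset.mem_union.1 hc with hc | hc
    · exact absurd (hν hbc hc) hb
    · have hcL := Finset.mem_sdiff.1 (mem_sdiff_of_mem_leftmostOuterCorner hc)
      exact (Finset.mem_filter.1 (Finset.mem_filter.1 hc).1).2 b
        (Finset.mem_sdiff.2 ⟨hLam hbc hcL.1, hb⟩) hbc
  refine ⟨hν, fun c b hbc hc => ?_, fun b hb => Finset.mem_union_left _ hb,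
    fun {b c} hb hc => key b c hb hc⟩
  by_cases hb : b ∈ ν
  · exact Finset.mem_union_left _ hb
  · rwa [key b c hb hc hbc]

theorem isLowerSet_outerAfter (hLam : IsLowerSet (Lam : Set (ℕ × ℕ)))
    (hν : IsLowerSet (ν : Set (ℕ × ℕ))) (u : ℕ) :
    IsLowerSet (outerAfter Lam ν u : Set (ℕ × ℕ)) := by
  induction u with
  | zero => exact hν
  | succ u ih => exact (rookExtension_union_leftmostOuterCorner hLam ih).isLowerSet_right

theorem outerAfter_subset (hν : ν ⊆ Lam) (u : ℕ) : outerAfter Lam ν u ⊆ Lam := by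
  induction u with
  | zero => exact hν
  | succ u ih => exact Finset.union_subset ih fun b hb =>
      (Finset.mem_sdiff.1 (mem_sdiff_of_mem_leftmostOuterCorner hb)).1

theorem sub_le_card_sdiff_outerAfter (u : ℕ) :
    (Lam \ ν).card - u ≤ (Lam \ outerAfter Lam ν u).card := by
  induction u with
  | zero => exact le_rfl
  | succ u ih =>
    have h₁ : (leftmostOuterCorner Lam (outerAfter Lam ν u)).card ≤ 1 :=
      Finset.card_le_one.2 fun b hb c hc => eq_of_mem_leftmostOuterCorner hb hc
    have h₂ := Finset.le_card_sdiff (leftmostOuterCorner Lam (outerAfter Lam ν u))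
      (Lam \ outerAfter Lam ν u)
    rw [sdiff_sdiff_left] at h₂
    have h₃ : (Lam \ outerAfter Lam ν (u + 1)).card = (Lam \ (outerAfter Lam ν u ⊔
      leftmostOuterCorner Lam (outerAfter Lam ν u))).card := rfl
    omega

theorem SkewFilling.IsEncodedBy.iterate_revStep {T : SkewFilling} {M : ℕ} {A : ℕ → Set (ℕ × ℕ)}
    (h : T.IsEncodedBy M A) (hLam : IsLowerSet (Lam : Set (ℕ × ℕ)))
    (hν : IsLowerSet (T.outer : Set (ℕ × ℕ))) (u : ℕ) :
    ((revStep Lam)^[u] T).outer = outerAfter Lam T.outer u ∧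
      ((revStep Lam)^[u] T).IsEncodedBy M
        (growth M A (fun u => (outerAfter Lam T.outer u : Set (ℕ × ℕ))) u) := by
  induction u with
  | zero => exact ⟨rfl, h⟩
  | succ u ih =>
    obtain ⟨ih₁, ih₂⟩ := ih
    rw [Function.iterate_succ_apply']
    constructor
    · simp only [revStep, KJdt.revKjdt, outerAfter, ih₁]
    · have := ih₂.revKjdt
        (X := leftmostOuterCorner Lam ((revStep Lam)^[u] T).outer)
        (fun b hb => (Finset.mem_sdiff.1 (mem_sdiff_of_mem_leftmostOuterCorner hb)).2)
        (fun b hb c hc => eq_of_mem_leftmostOuterCorner hb hc)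
        (by
          rw [ih₂.outer_eq]
          refine rookExtension_union_leftmostOuterCorner hLam ?_
          rw [ih₁]
          exact isLowerSet_outerAfter hLam hν u)
      rw [ih₁] at this
      rw [revStep, ih₁]
      exact this

theorem outerAfter_card_sdiff {T : SkewFilling} {M : ℕ} {A : ℕ → Set (ℕ × ℕ)}
    (h : T.IsEncodedBy M A) (hLam : IsLowerSet (Lam : Set (ℕ × ℕ)))
    (hν : IsLowerSet (T.outer : Set (ℕ × ℕ))) (hsub : T.outer ⊆ Lam) :
    outerAfter Lam T.outer (Lam \ T.outer).card = Lam := by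
  have h₁ := revKrect_outer Lam T
  rw [revKrect, (h.iterate_revStep hLam hν _).1] at h₁
  exact (outerAfter_subset hsub _).antisymm (Finset.sdiff_eq_empty_iff_subset.1 h₁)

end

/-! ### The length of the leftmost column -/

/-- Inside a rectangle of height `h`, let a straight shape have `a` boxes in the last column. After
the slides that fill the rectangle, exactly the first `h - a` boxes of column `0` are empty: both
`h - a` and the number of empty rows are the greatest length of a decreasing subsequence of the
tableau of slide numbers, at height `M` and at height `0`. -/
theorem IsGrowthDiagram.mem_column_zero_iff {M : ℕ} {G : ℕ → ℕ → Set (ℕ × ℕ)}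
    (hG : IsGrowthDiagram M G) {N h w a : ℕ} (ha : a ≤ h) (hempty : G 0 0 = ∅)
    (hlast : ∀ r, (r, w) ∈ G 0 M ↔ r < a)
    (hfull : ∀ b, b ∈ G N M ↔ b.1 < h ∧ b.2 < w + 1) (r : ℕ) :
    (r, 0) ∈ G N 0 ↔ r < h - a := by
  have hlow : ∀ u k, IsLowerSet (G u k) := fun u k => (hG.rookExtension u k).isLowerSet_left
  have hrow : ∀ r v, SlideInRow G N M r v → a ≤ r ∧ r < h := by
    rintro r v ⟨hv, c, hc, hc'⟩
    have h₁ := (hfull _).1 (hG.monotone M hv hc)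
    refine ⟨?_, h₁.1⟩
    by_contra! hr
    exact hc' (hG.monotone M (Nat.zero_le v) (hlow 0 M
      (Prod.mk_le_mk.2 ⟨le_rfl, Nat.le_of_lt_succ h₁.2⟩) ((hlast r).2 hr)))
  constructor
  · intro hr
    have h₁ : HasDecreasing (SlideInRow G N 0) (r + 1) :=
      hG.hasDecreasing_of_column (a := 0) (c := 0) (by simp [hempty])
        fun s hs => hlow N 0 (Prod.mk_le_mk.2 ⟨by omega, le_rfl⟩) hr
    obtain ⟨s, v, hs, hsv⟩ := (hG.hasDecreasing_iff.2 h₁).exists_row fun r v hv => (hrow r v hv).1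
    have := (hrow s v hsv).2
    omega
  · intro hr
    have h₁ : HasDecreasing (SlideInRow G N M) (h - a) :=
      hG.hasDecreasing_of_column (a := a) (c := w)
        (fun s hs hs' => by rw [hlast] at hs'; omega)
        fun s hs => (hfull _).2 ⟨by dsimp only; omega, w.lt_succ_self⟩
    obtain ⟨d, hd⟩ : ∃ d, h - a = d + 1 := ⟨h - a - 1, by omega⟩
    rw [hG.hasDecreasing_iff, hd] at h₁
    obtain ⟨s, v, hs, hv, c, hc, -⟩ := h₁.exists_row (a := 0) fun _ _ _ => Nat.zero_le _
    exact hlow N 0 (Prod.mk_le_mk.2 ⟨by omega, Nat.zero_le c⟩) (hG.monotone 0 hv hc)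

/-! ### The labels of the leftmost column -/

/-- Slides only remove labels from column `0`. -/
theorem IsGrowthDiagram.label_mem_column_zero {M : ℕ} {G : ℕ → ℕ → Set (ℕ × ℕ)}
    (hG : IsGrowthDiagram M G) {u u' i : ℕ} (huu : u ≤ u')
    (h : ∃ r, (r, 0) ∈ G u' (i + 1) ∧ (r, 0) ∉ G u' i) :
    ∃ r, (r, 0) ∈ G u (i + 1) ∧ (r, 0) ∉ G u i := by
  induction u', huu using Nat.le_induction with
  | base => exact h
  | succ u' _ ih =>
    obtain ⟨r, hr, hr'⟩ := h
    have hi : i < M := (hG.isTableauChain (u' + 1)).lt_of_mem hr hr'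
    rw [hG.rule u' i hi] at hr'
    exact ih (exists_mem_column_zero_of_switchShape ((hG.isTableauChain u').step i)
      (hG.rookExtension u' (i + 1)) hr hr')

/-- A slide that starts in the first `m` columns acts on these columns as if there were no others. -/
theorem slideChain_inter_columns {M m : ℕ} {A : ℕ → Set (ℕ × ℕ)} {ν : Set (ℕ × ℕ)}
    (hA : IsTableauChain M A) (hm : ∀ b ∈ ν, b ∉ A M → b.2 < m)
    (k : ℕ) :
    slideChain M (fun k => A k ∩ {b | b.2 < m}) (ν ∩ {b | b.2 < m}) k =
      slideChain M A ν k ∩ {b | b.2 < m} := by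
  rcases le_total M k with hk | hk
  · rw [slideChain_of_le _ _ hk, slideChain_of_le _ _ hk]
  · suffices H : slideChain M (fun k => A k ∩ {b | b.2 < m}) (ν ∩ {b | b.2 < m}) k =
        slideChain M A ν k ∩ {b | b.2 < m} ∧ ∀ b ∈ slideChain M A ν k, b ∉ A k → b.2 < m from H.1
    induction hk using Nat.decreasingInduction with
    | self => simpa only [slideChain_of_le _ _ le_rfl, true_and] using hm
    | of_succ k hk ih =>
      have h₁ := hA.step k
      rw [slideChain_of_lt _ _ hk, slideChain_of_lt _ _ hk, ih.1]
      exact ⟨switchShape_inter_columns h₁ ih.2, fun b hb hb' => lt_of_mem_switchShape h₁ ih.2 hb hb'⟩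

/-- As long as the first `m` columns of a rectangle are not full, the leftmost outer corner lies in
them. -/
theorem leftmostOuterCorner_columns {h w m : ℕ} (hmw : m ≤ w) {ν : Finset (ℕ × ℕ)}
    (hne : ((Finset.range h ×ˢ Finset.range m) \ ν.filter (·.2 < m)).Nonempty) :
    leftmostOuterCorner (Finset.range h ×ˢ Finset.range w) ν =
      leftmostOuterCorner (Finset.range h ×ˢ Finset.range m) (ν.filter (·.2 < m)) := by
  have hmem : ∀ b, b ∈ (Finset.range h ×ˢ Finset.range m) \ ν.filter (·.2 < m) ↔
      b ∈ (Finset.range h ×ˢ Finset.range w) \ ν ∧ b.2 < m := by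
    intro b
    simp only [Finset.mem_sdiff, Finset.mem_product, Finset.mem_range, Finset.mem_filter]
    constructor
    · rintro ⟨⟨h₁, h₂⟩, h₃⟩
      exact ⟨⟨⟨h₁, by omega⟩, fun hb => h₃ ⟨hb, h₂⟩⟩, h₂⟩
    · rintro ⟨⟨⟨h₁, -⟩, h₂⟩, h₃⟩
      exact ⟨⟨h₁, h₃⟩, fun hb => h₂ hb.1⟩
  have hcor : ∀ b, b ∈ outerCorners (Finset.range h ×ˢ Finset.range m) (ν.filter (·.2 < m)) ↔
      b ∈ outerCorners (Finset.range h ×ˢ Finset.range w) ν ∧ b.2 < m := by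
    intro b
    simp only [outerCorners, Finset.mem_filter (p := fun _ => _), hmem]
    constructor
    · rintro ⟨⟨h₁, h₂⟩, h₃⟩
      exact ⟨⟨h₁, fun c hc hcb => h₃ c ⟨hc, lt_of_le_of_lt hcb.2 h₂⟩ hcb⟩, h₂⟩
    · rintro ⟨⟨h₁, h₂⟩, h₃⟩
      exact ⟨⟨h₁, h₃⟩, fun c hc hcb => h₂ c hc.1 hcb⟩
  obtain ⟨x, hx⟩ := leftmostOuterCorner_nonempty hne
  have hx' := (hcor x).1 (Finset.mem_filter.1 hx).1
  have key : x ∈ leftmostOuterCorner (Finset.range h ×ˢ Finset.range w) ν := by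
    refine Finset.mem_filter.2 ⟨hx'.1, fun c hc => ?_⟩
    by_cases hcm : c.2 < m
    · exact (Finset.mem_filter.1 hx).2 c ((hcor c).2 ⟨hc, hcm⟩)
    · omega
  ext b
  exact ⟨fun hb => eq_of_mem_leftmostOuterCorner key hb ▸ hx,
    fun hb => eq_of_mem_leftmostOuterCorner hx hb ▸ key⟩

/-! ### The first columns of an increasing tableau -/

namespace IncreasingTableau

variable {μ : YoungDiagram} (P : IncreasingTableau μ)

/-- The boxes with entry `≤ k` in the first `m` columns. -/
def chain (m k : ℕ) : Set (ℕ × ℕ) := {b | (b ∈ μ ∧ b.2 < m) ∧ P.entry b.1 b.2 ≤ k}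

/-- The largest entry. -/
def maxEntry : ℕ := μ.cells.sup fun b => P.entry b.1 b.2

theorem entry_lt {b c : ℕ × ℕ} (hc : c ∈ μ) (hbc : b ≤ c) (hne : b ≠ c) :
    P.entry b.1 b.2 < P.entry c.1 c.2 := by
  obtain ⟨i, j⟩ := b
  obtain ⟨i', j'⟩ := c
  have hij : (i, j') ∈ μ := μ.up_left_mem hbc.1 le_rfl hc
  rcases (Prod.mk_le_mk.1 hbc).2.lt_or_eq with hj | rfl
  · have h₁ := P.row_strict hj hij
    rcases (Prod.mk_le_mk.1 hbc).1.lt_or_eq with hi | rfl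
    · exact h₁.trans (P.col_strict hi hc)
    · exact h₁
  · exact P.col_strict ((Prod.mk_le_mk.1 hbc).1.lt_of_ne fun h => hne (by rw [h])) hc

theorem entry_le {b c : ℕ × ℕ} (hc : c ∈ μ) (hbc : b ≤ c) :
    P.entry b.1 b.2 ≤ P.entry c.1 c.2 := by
  by_cases h : b = c
  · rw [h]
  · exact (P.entry_lt hc hbc h).le

theorem entry_le_maxEntry {b : ℕ × ℕ} (hb : b ∈ μ) : P.entry b.1 b.2 ≤ P.maxEntry :=
  Finset.le_sup (f := fun b : ℕ × ℕ => P.entry b.1 b.2) ((YoungDiagram.mem_cells _).2 hb)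

theorem mem_outer_firstColumns {m : ℕ} {b : ℕ × ℕ} :
    b ∈ (P.firstColumns m).outer ↔ b ∈ μ ∧ b.2 < m := by
  simp [firstColumns]

theorem chain_zero (m : ℕ) : P.chain m 0 = ∅ := by
  ext b
  simp only [chain, Set.mem_ofPred_eq, Set.mem_empty_iff_false, iff_false]
  rintro ⟨⟨hb, -⟩, h⟩
  have := P.pos (i := b.1) (j := b.2) hb
  omega

theorem chain_maxEntry (m : ℕ) :
    P.chain m P.maxEntry = ((P.firstColumns m).outer : Set (ℕ × ℕ)) := by
  ext b
  simp only [chain, Set.mem_ofPred_eq, Finset.mem_coe, mem_outer_firstColumns]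
  exact ⟨fun h => h.1, fun h => ⟨h, P.entry_le_maxEntry h.1⟩⟩

theorem isLowerSet_chain (m k : ℕ) : IsLowerSet (P.chain m k) :=
  fun _ _ hcb ⟨⟨hb, hm⟩, hk⟩ => ⟨⟨μ.isLowerSet hcb hb, lt_of_le_of_lt hcb.2 hm⟩,
    (P.entry_le hb hcb).trans hk⟩

theorem isLowerSet_outer_firstColumns (m : ℕ) :
    IsLowerSet ((P.firstColumns m).outer : Set (ℕ × ℕ)) :=
  P.chain_maxEntry m ▸ P.isLowerSet_chain m _

theorem chain_inter_columns (m k : ℕ) : P.chain (m + 1) k ∩ {b | b.2 < m} = P.chain m k := by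
  ext b
  simp only [chain, Set.mem_inter_iff, Set.mem_ofPred_eq]
  constructor
  · exact fun h => ⟨⟨h.1.1.1, h.2⟩, h.1.2⟩
  · exact fun h => ⟨⟨⟨h.1.1, h.1.2.trans m.lt_succ_self⟩, h.2⟩, h.1.2⟩

theorem isTableauChain_chain (m : ℕ) : IsTableauChain P.maxEntry (P.chain m) where
  step k := by
    refine ⟨P.isLowerSet_chain m k, P.isLowerSet_chain m (k + 1),
      fun b hb => ⟨hb.1, hb.2.trans k.le_succ⟩, fun {b c} hb hc hbc => ?_⟩
    by_contra hne
    have := P.entry_lt hc.1.1 hbc hne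
    have := hc.2
    exact hb ⟨⟨μ.isLowerSet hbc hc.1.1, lt_of_le_of_lt hbc.2 hc.1.2⟩, by omega⟩
  stable k hk := by
    ext b
    exact ⟨fun h => ⟨h.1, P.entry_le_maxEntry h.1.1⟩, fun h => ⟨h.1, h.2.trans hk⟩⟩

theorem isEncodedBy_firstColumns (m : ℕ) :
    (P.firstColumns m).IsEncodedBy P.maxEntry (P.chain m) where
  isTableauChain := P.isTableauChain_chain m
  outer_eq := P.chain_maxEntry m
  label_iff b i := by
    by_cases hb : b ∈ μ ∧ b.2 < m
    · have hpos := P.pos (i := b.1) (j := b.2) hb.1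
      have hF : (P.firstColumns m).fill b = Cell.label (P.entry b.1 b.2) := by
        simp [firstColumns, hb]
      simp only [hF, Cell.label.injEq, chain, Set.mem_ofPred_eq, hb, and_self, true_and]
      constructor
      · exact fun h => ⟨i - 1, by omega, by omega, by omega⟩
      · rintro ⟨j, h₁, h₂, h₃⟩
        omega
    · have hF : (P.firstColumns m).fill b = Cell.blank := by
        simp only [firstColumns, YoungDiagram.mem_cells, if_neg hb]
      rw [hF]
      constructor
      · intro h; cases h
      · rintro ⟨j, -, hj, -⟩
        exact absurd hj.1 hb
  ne_bullet b := by
    simp only [firstColumns]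
    split_ifs <;> simp

/-- The rectangle with `m` columns that is as high as `μ`. It is the bounding rectangle of the first
`m` columns if `μ` has at least `m ≥ 1` columns. -/
def rectangle (μ : YoungDiagram) (m : ℕ) : Finset (ℕ × ℕ) :=
  Finset.range (μ.colLen 0) ×ˢ Finset.range m

theorem mem_rectangle {m : ℕ} {b : ℕ × ℕ} : b ∈ rectangle μ m ↔ b.1 < μ.colLen 0 ∧ b.2 < m := by
  simp [rectangle]

theorem isLowerSet_rectangle (m : ℕ) : IsLowerSet (rectangle μ m : Set (ℕ × ℕ)) := by
  intro b c hcb hb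
  rw [Finset.mem_coe, mem_rectangle] at hb ⊢
  exact ⟨lt_of_le_of_lt hcb.1 hb.1, lt_of_le_of_lt hcb.2 hb.2⟩

theorem outer_firstColumns_subset (m : ℕ) : (P.firstColumns m).outer ⊆ rectangle μ m := by
  intro b hb
  rw [mem_outer_firstColumns] at hb
  exact mem_rectangle.2
    ⟨μ.mem_iff_lt_colLen.1 (μ.up_left_mem le_rfl (Nat.zero_le b.2) hb.1), hb.2⟩

theorem boundingRectangle_firstColumns {l : ℕ} (hl : l < μ.rowLen 0) :
    boundingRectangle (P.firstColumns (l + 1)).outer = rectangle μ (l + 1) := by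
  have h₁ : (P.firstColumns (l + 1)).outer.sup (fun b => b.1 + 1) = μ.colLen 0 := by
    apply le_antisymm
    · exact Finset.sup_le fun b hb => (mem_rectangle.1 (P.outer_firstColumns_subset _ hb)).1
    · rcases Nat.eq_zero_or_pos (μ.colLen 0) with h | h
      · omega
      · have hb : (μ.colLen 0 - 1, 0) ∈ (P.firstColumns (l + 1)).outer :=
          P.mem_outer_firstColumns.2 ⟨μ.mem_iff_lt_colLen.2 (by omega), l.succ_pos⟩
        have := Finset.le_sup (f := fun b : ℕ × ℕ => b.1 + 1) hb
        dsimp only at this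
        omega
  have h₂ : (P.firstColumns (l + 1)).outer.sup (fun b => b.2 + 1) = l + 1 := by
    apply le_antisymm
    · exact Finset.sup_le fun b hb => (mem_rectangle.1 (P.outer_firstColumns_subset _ hb)).2
    · exact Finset.le_sup (f := fun b : ℕ × ℕ => b.2 + 1) (b := (0, l))
        (P.mem_outer_firstColumns.2 ⟨μ.mem_iff_lt_rowLen.2 hl, l.lt_succ_self⟩)
  rw [boundingRectangle, h₁, h₂, rectangle]

/-- The growth diagram of the reverse K-rectification of the first `m` columns. -/
def rectGrowth (m : ℕ) : ℕ → ℕ → Set (ℕ × ℕ) :=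
  growth P.maxEntry (P.chain m)
    fun u => (outerAfter (rectangle μ m) (P.firstColumns m).outer u : Set (ℕ × ℕ))

/-- The number of slides in the reverse K-rectification of the first `m` columns. -/
def slideCount (m : ℕ) : ℕ := (rectangle μ m \ (P.firstColumns m).outer).card

theorem rookExtension_outerAfter (m u : ℕ) :
    RookExtension (outerAfter (rectangle μ m) (P.firstColumns m).outer u : Set (ℕ × ℕ))
      (outerAfter (rectangle μ m) (P.firstColumns m).outer (u + 1) : Set (ℕ × ℕ)) :=
  rookExtension_union_leftmostOuterCorner (isLowerSet_rectangle m)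
    (isLowerSet_outerAfter (isLowerSet_rectangle m) (P.isLowerSet_outer_firstColumns m) u)

theorem isGrowthDiagram_rectGrowth (m : ℕ) : IsGrowthDiagram P.maxEntry (P.rectGrowth m) :=
  isGrowthDiagram_growth (P.isTableauChain_chain m) (P.chain_maxEntry m)
    (P.rookExtension_outerAfter m)

theorem rectGrowth_maxEntry (m u : ℕ) : P.rectGrowth m u P.maxEntry =
    (outerAfter (rectangle μ m) (P.firstColumns m).outer u : Set (ℕ × ℕ)) :=
  growth_outer (P.chain_maxEntry m) u

theorem isEncodedBy_revKrect (m : ℕ) :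
    (revKrect (rectangle μ m) (P.firstColumns m)).IsEncodedBy P.maxEntry
      (P.rectGrowth m (P.slideCount m)) :=
  ((P.isEncodedBy_firstColumns m).iterate_revStep (isLowerSet_rectangle m)
    (P.isLowerSet_outer_firstColumns m) _).2

theorem rectGrowth_slideCount_maxEntry (m : ℕ) :
    P.rectGrowth m (P.slideCount m) P.maxEntry = (rectangle μ m : Set (ℕ × ℕ)) := by
  rw [rectGrowth_maxEntry, slideCount,
    outerAfter_card_sdiff (P.isEncodedBy_firstColumns m) (isLowerSet_rectangle m)
      (P.isLowerSet_outer_firstColumns m) (P.outer_firstColumns_subset m)]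

theorem slideCount_le_succ (m : ℕ) : P.slideCount m ≤ P.slideCount (m + 1) := by
  refine Finset.card_le_card fun b hb => ?_
  simp only [Finset.mem_sdiff, mem_rectangle, mem_outer_firstColumns] at hb ⊢
  exact ⟨⟨hb.1.1, hb.1.2.trans m.lt_succ_self⟩, fun h => hb.2 ⟨h.1, hb.1.2⟩⟩

/-- The slides of the first `m + 1` columns begin with those of the first `m` columns. -/
theorem rectGrowth_succ_inter_columns (m : ℕ) {u : ℕ} (hu : u ≤ P.slideCount m) :
    (outerAfter (rectangle μ (m + 1)) (P.firstColumns (m + 1)).outer u).filter (·.2 < m) =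
        outerAfter (rectangle μ m) (P.firstColumns m).outer u ∧
      ∀ k, P.rectGrowth (m + 1) u k ∩ {b | b.2 < m} = P.rectGrowth m u k := by
  induction u with
  | zero =>
    refine ⟨?_, P.chain_inter_columns m⟩
    ext b
    simp only [outerAfter, Finset.mem_filter, mem_outer_firstColumns]
    exact ⟨fun h => ⟨h.1.1, h.2⟩, fun h => ⟨⟨h.1, h.2.trans m.lt_succ_self⟩, h.2⟩⟩
  | succ u ih =>
    obtain ⟨ih₁, ih₂⟩ := ih (Nat.le_of_succ_le hu)
    have hne : (rectangle μ m \
        outerAfter (rectangle μ m) (P.firstColumns m).outer u).Nonempty := by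
      have h₁ := sub_le_card_sdiff_outerAfter (Lam := rectangle μ m)
        (ν := (P.firstColumns m).outer) u
      rw [← Finset.card_pos]
      have : u < (rectangle μ m \ (P.firstColumns m).outer).card := hu
      omega
    have hcorner := leftmostOuterCorner_columns m.le_succ
      (ν := outerAfter (rectangle μ (m + 1)) (P.firstColumns (m + 1)).outer u)
      (h := μ.colLen 0) (by rw [ih₁]; exact hne)
    rw [ih₁] at hcorner
    change leftmostOuterCorner (rectangle μ (m + 1)) _ =
      leftmostOuterCorner (rectangle μ m) _ at hcorner
    have hcol : ∀ b ∈ leftmostOuterCorner (rectangle μ m)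
        (outerAfter (rectangle μ m) (P.firstColumns m).outer u), b.2 < m := fun b hb =>
      (mem_rectangle.1 (Finset.mem_sdiff.1 (mem_sdiff_of_mem_leftmostOuterCorner hb)).1).2
    have hout : (outerAfter (rectangle μ (m + 1)) (P.firstColumns (m + 1)).outer
        (u + 1)).filter (·.2 < m) =
        outerAfter (rectangle μ m) (P.firstColumns m).outer (u + 1) := by
      rw [outerAfter, outerAfter, Finset.filter_union, ih₁, hcorner,
        Finset.filter_true_of_mem hcol]
    refine ⟨hout, fun k => ?_⟩
    have hslide := slideChain_inter_columns (m := m)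
      ((P.isGrowthDiagram_rectGrowth (m + 1)).isTableauChain u)
      (ν := (outerAfter (rectangle μ (m + 1)) (P.firstColumns (m + 1)).outer (u + 1) :
        Set (ℕ × ℕ))) (by
        intro b hb hb'
        rw [rectGrowth_maxEntry] at hb'
        have := (Finset.mem_union.1 (Finset.mem_coe.1 hb)).resolve_left hb'
        rw [hcorner] at this
        exact hcol b this) k
    have hout' : (outerAfter (rectangle μ (m + 1)) (P.firstColumns (m + 1)).outer (u + 1) :
        Set (ℕ × ℕ)) ∩ {b | b.2 < m} =
        (outerAfter (rectangle μ m) (P.firstColumns m).outer (u + 1) : Set (ℕ × ℕ)) := by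
      rw [← hout]
      ext b
      simp
    rw [hout', funext ih₂] at hslide
    exact hslide.symm

end IncreasingTableau

/-! ### The columns of the left key -/

theorem mem_columnList {F : Filling} {r j n : ℕ} :
    n ∈ columnList F r j ↔ ∃ i < r, F (i, j) = Cell.label n := by
  simp only [columnList, List.mem_filterMap, List.mem_range]
  refine exists_congr fun i => and_congr_right fun _ => ?_
  cases F (i, j) <;> simp

theorem pairwise_columnList {F : Filling} {r j : ℕ}
    (hF : ∀ i i' a b, i < i' → F (i, j) = Cell.label a → F (i', j) = Cell.label b → a < b) :
    (columnList F r j).Pairwise (· < ·) := by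
  rw [columnList, List.pairwise_filterMap]
  refine List.pairwise_lt_range.imp fun {i i'} hi a ha b hb => hF i i' a b hi ?_ ?_
  · revert ha; cases F (i, j) <;> simp
  · revert hb; cases F (i', j) <;> simp

theorem length_columnList {F : Filling} {r j q : ℕ}
    (hF : ∀ i < r, (∃ n, F (i, j) = Cell.label n) ↔ q ≤ i) :
    (columnList F r j).length = r - q := by
  induction r with
  | zero => simp [columnList]
  | succ r ih =>
    have h₁ := ih fun i hi => hF i (hi.trans r.lt_succ_self)
    have h₂ := hF r r.lt_succ_self
    rw [columnList] at h₁ ⊢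
    rw [List.range_succ, List.filterMap_append, List.length_append, h₁]
    by_cases hq : q ≤ r
    · obtain ⟨n, hn⟩ := h₂.2 hq
      simp only [List.filterMap_cons, hn, List.filterMap_nil, List.length_singleton]
      omega
    · have : ∀ n, F (r, j) ≠ Cell.label n := fun n hn => hq (h₂.1 ⟨n, hn⟩)
      cases hc : F (r, j) with
      | label n => exact absurd hc (this n)
      | _ =>
        simp only [List.filterMap_cons, hc, List.filterMap_nil, List.length_nil]
        omega

/-- If the labels of one column occur in another one, they dominate the labels of the latter
position by position, since the shorter column is a sublist of the longer one. -/
theorem getElem_le_getElem_of_subset {L L' : List ℕ} (hL : L.Pairwise (· < ·))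
    (hL' : L'.Pairwise (· < ·)) (hsub : L' ⊆ L) {i a b : ℕ} (ha : L[i]? = some a)
    (hb : L'[i]? = some b) : a ≤ b := by
  have hs : L'.Sublist L :=
    List.sublist_of_subperm_of_pairwise (List.subperm_of_subset (hL'.imp ne_of_lt) hsub) hL' hL
  obtain ⟨f, hf⟩ := List.sublist_iff_exists_orderEmbedding_getElem?_eq.1 hs
  have h₁ : L[f i]? = some b := by rw [← hf, hb]
  have h₂ : i ≤ f i := f.strictMono.le_apply
  obtain ⟨hi, rfl⟩ := List.getElem?_eq_some_iff.1 ha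
  obtain ⟨hi', rfl⟩ := List.getElem?_eq_some_iff.1 h₁
  rcases h₂.eq_or_lt with h | h
  · simp only [← h, le_refl]
  · exact (List.pairwise_iff_getElem.1 hL i (f i) hi hi' h).le

section

variable {μ : YoungDiagram} (P : IncreasingTableau μ)

open IncreasingTableau

/-- The description of the columns `l ≥ 1` also holds for `l = 0`, where there are no slides. -/
theorem leftKeyColumn_eq {l : ℕ} (hl : l < μ.rowLen 0) :
    leftKeyColumn P l =
      columnList (revKrect (rectangle μ (l + 1)) (P.firstColumns (l + 1))).fill (μ.colLen 0) 0 := by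
  cases l with
  | succ l => rw [leftKeyColumn, P.boundingRectangle_firstColumns hl]
  | zero =>
    have : rectangle μ 1 \ (P.firstColumns 1).outer = ∅ := by
      rw [Finset.sdiff_eq_empty_iff_subset]
      rintro ⟨r, c⟩ hb
      have hb' := mem_rectangle.1 hb
      obtain rfl : c = 0 := Nat.lt_one_iff.1 hb'.2
      exact P.mem_outer_firstColumns.2 ⟨μ.mem_iff_lt_colLen.2 hb'.1, hb'.2⟩
    rw [leftKeyColumn, revKrect, zero_add, this, Finset.card_empty, Function.iterate_zero_apply]

theorem length_leftKeyColumn {l : ℕ} (hl : l < μ.rowLen 0) :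
    (leftKeyColumn P l).length = μ.colLen l := by
  have hle : μ.colLen l ≤ μ.colLen 0 := μ.colLen_anti _ _ l.zero_le
  have hG := P.isGrowthDiagram_rectGrowth (l + 1)
  have henc := P.isEncodedBy_revKrect (l + 1)
  rw [leftKeyColumn_eq P hl, length_columnList (q := μ.colLen 0 - μ.colLen l), Nat.sub_sub_self hle]
  intro i hi
  have hiff := hG.mem_column_zero_iff (N := P.slideCount (l + 1)) (w := l) hle
    (P.chain_zero (l + 1))
    (fun r => by
      rw [rectGrowth_maxEntry, ← YoungDiagram.mem_iff_lt_colLen]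
      simp [outerAfter, mem_outer_firstColumns])
    (fun b => by rw [rectGrowth_slideCount_maxEntry, Finset.mem_coe, mem_rectangle]) i
  rw [← not_lt, ← hiff]
  constructor
  · rintro ⟨n, hn⟩ h
    obtain ⟨j, -, -, hj⟩ := (henc.label_iff _ _).1 hn
    exact hj ((hG.isTableauChain _).monotone j.zero_le h)
  · intro h
    obtain ⟨j, -, -, hj⟩ := exists_first_entry h
      (P.rectGrowth_slideCount_maxEntry (l + 1) ▸
        Finset.mem_coe.2 (mem_rectangle.2 ⟨hi, l.succ_pos⟩)) P.maxEntry.zero_le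
    exact ⟨j + 1, (henc.label_iff _ _).2 ⟨j, rfl, hj⟩⟩

theorem pairwise_leftKeyColumn {l : ℕ} (hl : l < μ.rowLen 0) :
    (leftKeyColumn P l).Pairwise (· < ·) := by
  have henc := P.isEncodedBy_revKrect (l + 1)
  rw [leftKeyColumn_eq P hl]
  refine pairwise_columnList fun i i' a b hi ha hb => ?_
  obtain ⟨j, rfl, -, hj⟩ := (henc.label_iff _ _).1 ha
  obtain ⟨j', rfl, hj', -⟩ := (henc.label_iff _ _).1 hb
  by_contra! h
  have := (henc.isTableauChain.step j).eq_of_le hj (henc.isTableauChain.monotone h hj')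
    (Prod.mk_le_mk.2 ⟨hi.le, le_rfl⟩)
  simp only [Prod.mk.injEq, and_true] at this
  omega

theorem leftKeyColumn_succ_subset {l : ℕ} (hl : l + 1 < μ.rowLen 0) :
    leftKeyColumn P (l + 1) ⊆ leftKeyColumn P l := by
  intro n hn
  rw [leftKeyColumn_eq P hl, mem_columnList] at hn
  rw [leftKeyColumn_eq P (Nat.lt_of_succ_lt hl), mem_columnList]
  obtain ⟨i, -, hi⟩ := hn
  obtain ⟨j, rfl, hj⟩ := ((P.isEncodedBy_revKrect (l + 2)).label_iff _ _).1 hi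
  obtain ⟨r, hr, hr'⟩ := (P.isGrowthDiagram_rectGrowth (l + 2)).label_mem_column_zero
    (P.slideCount_le_succ (l + 1)) ⟨i, hj⟩
  have hrestrict := (P.rectGrowth_succ_inter_columns (l + 1) le_rfl).2
  have h₁ : (r, 0) ∈ P.rectGrowth (l + 1) (P.slideCount (l + 1)) (j + 1) :=
    hrestrict (j + 1) ▸ ⟨hr, l.succ_pos⟩
  have h₂ : (r, 0) ∉ P.rectGrowth (l + 1) (P.slideCount (l + 1)) j := by
    rw [← hrestrict j]
    exact fun h => hr' h.1
  have henc := P.isEncodedBy_revKrect (l + 1)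
  refine ⟨r, ?_, (henc.label_iff _ _).2 ⟨j, rfl, h₁, h₂⟩⟩
  have := henc.outer_eq ▸ Finset.mem_coe.2 (henc.mem_outer h₁)
  rw [rectGrowth_slideCount_maxEntry] at this
  exact (mem_rectangle.1 (Finset.mem_coe.1 this)).1

theorem leftKeyColumn_subset {l l' : ℕ} (hll : l ≤ l') (hl' : l' < μ.rowLen 0) :
    leftKeyColumn P l' ⊆ leftKeyColumn P l := by
  induction l', hll using Nat.le_induction with
  | base => exact List.Subset.refl _
  | succ l' _ ih =>
    exact fun n hn => ih (Nat.lt_of_succ_lt hl') (leftKeyColumn_succ_subset P hl' hn)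

theorem leftKey_eq_label_iff {i j n : ℕ} : leftKey P (i, j) = Cell.label n ↔
    j < μ.rowLen 0 ∧ (leftKeyColumn P j)[i]? = some n := by
  unfold leftKey
  dsimp only
  split_ifs with h
  · cases (leftKeyColumn P j)[i]? <;> simp [h]
  · simp [h]

end

end KJdt

theorem mainTheorem1 (μ : YoungDiagram) (P : KJdt.IncreasingTableau μ) :
    (KJdt.leftKey P).shape = (μ.cells : Set (ℕ × ℕ)) ∧ (KJdt.leftKey P).IsKey := by
  refine ⟨?_, ⟨?_, ?_⟩, ?_⟩
  · ext ⟨i, j⟩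
    simp only [KJdt.Filling.shape, Set.mem_ofPred_eq, KJdt.leftKey_eq_label_iff, Finset.mem_coe,
      YoungDiagram.mem_cells]
    constructor
    · rintro ⟨n, hj, hn⟩
      obtain ⟨hi, -⟩ := List.getElem?_eq_some_iff.1 hn
      rw [KJdt.length_leftKeyColumn P hj] at hi
      exact YoungDiagram.mem_iff_lt_colLen.2 hi
    · intro h
      have hj : j < μ.rowLen 0 :=
        YoungDiagram.mem_iff_lt_rowLen.1 (μ.up_left_mem i.zero_le le_rfl h)
      have hi : i < (KJdt.leftKeyColumn P j).length := by
        rw [KJdt.length_leftKeyColumn P hj]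
        exact YoungDiagram.mem_iff_lt_colLen.1 h
      exact ⟨_, hj, List.getElem?_eq_getElem hi⟩
  · intro i j₁ j₂ a b hj ha hb
    obtain ⟨h₁, ha⟩ := (KJdt.leftKey_eq_label_iff P).1 ha
    obtain ⟨h₂, hb⟩ := (KJdt.leftKey_eq_label_iff P).1 hb
    exact KJdt.getElem_le_getElem_of_subset (KJdt.pairwise_leftKeyColumn P h₁)
      (KJdt.pairwise_leftKeyColumn P h₂) (KJdt.leftKeyColumn_subset P hj.le h₂) ha hb
  · intro i₁ i₂ j a b hi ha hb
    obtain ⟨h₁, ha⟩ := (KJdt.leftKey_eq_label_iff P).1 ha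
    obtain ⟨-, hb⟩ := (KJdt.leftKey_eq_label_iff P).1 hb
    obtain ⟨hi₁, rfl⟩ := List.getElem?_eq_some_iff.1 ha
    obtain ⟨hi₂, rfl⟩ := List.getElem?_eq_some_iff.1 hb
    exact List.pairwise_iff_getElem.1 (KJdt.pairwise_leftKeyColumn P h₁) i₁ i₂ hi₁ hi₂ hi
  · rintro j n ⟨i, hn⟩
    obtain ⟨h₁, hn⟩ := (KJdt.leftKey_eq_label_iff P).1 hn
    have hmem := KJdt.leftKeyColumn_succ_subset P h₁ (List.mem_of_getElem? hn)
    obtain ⟨i', hi', rfl⟩ := List.getElem_of_mem hmem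
    exact ⟨i', (KJdt.leftKey_eq_label_iff P).2
      ⟨Nat.lt_of_succ_lt h₁, List.getElem?_eq_getElem hi'⟩⟩
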